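/- Let $p\ge 3$ be odd, let $q\in\mathbb C$ be a primitive $p$-th root of unity, fix a square root $q^{1/2}$, and put $[n]=\frac{q^n-q^{-n}}{q-q^{-1}}$, $[n]!=[1]\cdots[n]$. Let $A$ be the $p^3$-dimensional $*$-algebra generated by $\eta_+,\eta_-,\delta$ with $\eta_-\eta_+=q^2\eta_+\eta_-$, $\eta_\pm\delta=q^2\delta\eta_\pm$, $\delta^p=1$, $\eta_\pm^p=0$, $\eta_\pm^*=\eta_\pm$, $\delta^*=\delta$, with basis $\eta_+^n\eta_-^m\delta^k$ ($0\le n,m,k<p$), and let $\mathcal I:A\to\mathbb C$ be the linear functional with $\mathcal I(\eta_+^n\eta_-^m\delta^k)=q^{-1}$ if $n=m=p-1$, $k\equiv0\bmod p$, and $0$ otherwise. Let $A(E_q(1,1))$ be the $*$-algebra of finite sums $\sum_n a_nf_n$ with $a_n\in A$, $f_n\in C^\infty(\mathbb R^2)$ (functions of the central self-adjoint variables $z=(z_+,z_-)$), and $A_0(E_q(1,1))$ its subspace where the $f_n$ have compact support. On the latter put $I_E(\sum_n a_nf_n)=\sum_n\mathcal I(a_n)\iint f_n\,dz_+dz_-$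 and $(F,G)_E=I_E(FG^*)$. For $\lambda=(\lambda_+,\lambda_-)\in\mathbb R^2$ let $p_\pm,\kappa$ act on the span of $\delta^m$, $m\in\mathbb Z/p$, by $L^\lambda(p_\pm)\delta^m=\lambda_\pm\delta^{m\pm1}$, $L^\lambda(\kappa)\delta^m=q^m\delta^m$, let $P_\pm=p_\pm^p$, $\epsilon_\pm=-q^{\mp1/2}p_\pm\kappa^{-1}$, $e_\pm^x=\sum_{m=0}^{p-1}\frac{q^{\pm m(m-1)/2}}{[m]!}x^m$, and $$T^\lambda=e^{-iL^\lambda(P_+)\otimes z_+-iL^\lambda(P_-)\otimes z_-}\,e_+^{iL^\lambda(\epsilon_+)\otimes\eta_+}\,e_-^{iL^\lambda(\epsilon_-)\otimes\eta_-}\,\frac1p\sum_{m,k=0}^{p-1}q^{-mk}L^\lambda(\kappa)^m\otimes\delta^k .$$ The matrix elements are $D^\lambda_{mn}=\{\delta^{p-m}\otimes1,T^\lambda(\delta^n\otimes 1)\}_S$, where $\{a\otimes F,b\otimes G\}_S=F^*G\,(a,b)_S$ and $(\cdot,\cdot)_S$ is the sesquilinear form, antilinear in its first argument, with $(\delta^j,\delta^k)_S=1$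 if $j+k\equiv0\bmod p$ and $0$ otherwise. (So $D^\lambda_{mn}\in A(E_q(1,1))$ is the coefficient of $\delta^m$ in $T^\lambda\delta^n$.) Then for all $n,m$ modulo $p$, as distributions in $(\lambda,\lambda')\in\mathbb R^2\times\mathbb R^2$, $$(D^\lambda_{n0},D^{\lambda'}_{m0})_E=\Lambda\,\delta(\lambda_+-\lambda'_+)\,\delta(\lambda_--\lambda'_-)\,\delta_{n+m,\,0\,(\mathrm{mod}\ p)},\qquad \Lambda=\frac{(2\pi)^2}{p^2}\sum_{k=0}^{p-1}\frac1{([k]!\,[p-1-k]!)^2}.$$ Here the left side is understood as follows: for every $\chi\in C_c^\infty(\mathbb R^2)$ with $\chi(0)=1$, the elements $\chi(z/R)D^\lambda_{n0}$ ($R>0$) lie in $A_0(E_q(1,1))$, and for every $\Phi\in C_c^\infty(\mathbb R^2\times\mathbb R^2)$ the integrals $\int\Phi(\lambda,\lambda')\,\big(\chi(z/R)D^\lambda_{n0},\,\chi(z/R)D^{\lambda'}_{m0}\big)_E\,d\lambda\,d\lambda'$ converge absolutely and tend, as $R\to\infty$, to $\Lambda\int_{\mathbb R^2}\Phi(\lambda,\lambda)\,d\lambda$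 if $n+m\equiv0\bmod p$ and to $0$ otherwise. -/

import Mathlib

open scoped ContDiff ComplexConjugate
open MeasureTheory Filter Topology

noncomputable section

/-! ### q-numbers -/

/-- The q-number `[n] = (q^n - q^{-n}) / (q - q^{-1})`. -/
def qNum (q : ℂ) (n : ℕ) : ℂ := (q ^ n - q⁻¹ ^ n) / (q - q⁻¹)

/-- The q-factorial `[n]! = [1][2]⋯[n]`. -/
def qFact (q : ℂ) (n : ℕ) : ℂ := ∏ k ∈ Finset.range n, qNum q (k + 1)

/-- For `q ^ p = 1`, the power `q ^ t` with exponent `t` modulo `p`. -/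
def qPow (p : ℕ) (q : ℂ) (t : ZMod p) : ℂ := q ^ t.val

section qPow

set_option linter.unusedSectionVars false

variable (p : ℕ) [NeZero p] (q : ℂ) [hq : Fact (IsPrimitiveRoot q p)]

theorem qPow_natCast (n : ℕ) : qPow p q (n : ZMod p) = q ^ n := by
  rw [qPow, ZMod.val_natCast]
  conv_rhs => rw [← Nat.mod_add_div n p]
  rw [pow_add, pow_mul, hq.out.pow_eq_one, one_pow, mul_one]

theorem qPow_zero : qPow p q 0 = 1 := by simp [qPow]

theorem qPow_add (s t : ZMod p) : qPow p q (s + t) = qPow p q s * qPow p q t := by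
  have h := qPow_natCast p q (s.val + t.val)
  simpa [pow_add, qPow] using h

theorem conj_qPow (t : ZMod p) : conj (qPow p q t) = qPow p q (-t) := by
  have h1 : qPow p q t * qPow p q (-t) = 1 := by
    rw [← qPow_add, add_neg_cancel, qPow_zero]
  have h2 : ‖qPow p q t‖ = 1 := by
    rw [qPow, norm_pow, hq.out.norm'_eq_one (NeZero.ne p), one_pow]
  rw [← Complex.inv_eq_conj h2]
  exact inv_eq_of_mul_eq_one_right h1

end qPow

/-! ### The reduced quantum Poincaré group

The `*`-algebra with generators `η₊, η₋, δ` and relations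
`η₋ η₊ = q² η₊ η₋`, `η± δ = q² δ η±`, `δ ^ p = 1`, `η± ^ p = 0`, `η±* = η±`, `δ* = δ`.
It is realised on its basis of monomials `η₊ ^ a η₋ ^ b δ ^ c`, `0 ≤ a, b < p`, `c` modulo `p`. -/

/-- Exponents `(a, b, c)` of the basis monomials `η₊ ^ a η₋ ^ b δ ^ c`. -/
abbrev PIdx (p : ℕ) : Type := Fin p × Fin p × ZMod p

/-- The algebra `A(E(1,1|p))`: an element is the family of its coefficients in the monomial basis. -/
def RedPoincare (p : ℕ) (_q : ℂ) : Type := PIdx p → ℂ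

namespace RedPoincare

variable (p : ℕ) (q : ℂ)

instance : AddCommGroup (RedPoincare p q) := inferInstanceAs (AddCommGroup (PIdx p → ℂ))
instance : Module ℂ (RedPoincare p q) := inferInstanceAs (Module ℂ (PIdx p → ℂ))

/-- The coefficient of `f` at a basis monomial. -/
def coeff {p : ℕ} {q : ℂ} (f : RedPoincare p q) (x : PIdx p) : ℂ := f x

/-- The monomial `η₊ ^ a η₋ ^ b δ ^ c`. -/
def mono (x : PIdx p) : RedPoincare p q := fun y => if y = x then 1 else 0

variable {p q}

@[ext] theorem ext {f g : RedPoincare p q} (h : ∀ x, f.coeff x = g.coeff x) : f = g := funext h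

@[simp] theorem coeff_add (f g : RedPoincare p q) (x) : (f + g).coeff x = f.coeff x + g.coeff x :=
  rfl
@[simp] theorem coeff_zero (x) : (0 : RedPoincare p q).coeff x = 0 := rfl
@[simp] theorem coeff_smul (c : ℂ) (f : RedPoincare p q) (x) : (c • f).coeff x = c * f.coeff x :=
  rfl
theorem coeff_mono (x y : PIdx p) : (mono p q x).coeff y = if y = x then 1 else 0 := rfl

/-- The exponent of `q` that arises in
`(η₊^a η₋^b δ^c)(η₊^a' η₋^b' δ^c') = q^(2ba' - 2c(a'+b')) η₊^(a+a') η₋^(b+b') δ^(c+c')`. -/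
def twist (y z : PIdx p) : ZMod p :=
  2 * (y.2.1 : ℕ) * (z.1 : ℕ) - 2 * y.2.2 * ((z.1 : ℕ) + (z.2.1 : ℕ))

/-- `x` is the exponent of the product of the monomials with exponents `y` and `z`. -/
def IsSum (y z x : PIdx p) : Prop :=
  (y.1 : ℕ) + z.1 = x.1 ∧ (y.2.1 : ℕ) + z.2.1 = x.2.1 ∧ y.2.2 + z.2.2 = x.2.2

instance (y z x : PIdx p) : Decidable (IsSum y z x) := by unfold IsSum; infer_instance

/-- The structure constants of the monomial basis. -/
def sc (q : ℂ) (y z x : PIdx p) : ℂ := if IsSum y z x then qPow p q (twist y z) else 0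

section ring

variable [NeZero p]

instance : Mul (RedPoincare p q) :=
  ⟨fun f g x => ∑ y : PIdx p, ∑ z : PIdx p, sc q y z x * (f.coeff y * g.coeff z)⟩

instance : One (RedPoincare p q) := ⟨mono p q (0, 0, 0)⟩

theorem coeff_mul (f g : RedPoincare p q) (x) :
    (f * g).coeff x = ∑ y : PIdx p, ∑ z : PIdx p, sc q y z x * (f.coeff y * g.coeff z) := rfl

theorem one_def : (1 : RedPoincare p q) = mono p q (0, 0, 0) := rfl

variable [hq : Fact (IsPrimitiveRoot q p)]

theorem sc_assoc (y z u x : PIdx p) :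
    ∑ w, sc q y z w * sc q w u x = ∑ w, sc q z u w * sc q y w x := by
  by_cases h : (y.1 : ℕ) + z.1 + u.1 = x.1 ∧ (y.2.1 : ℕ) + z.2.1 + u.2.1 = x.2.1 ∧
      y.2.2 + z.2.2 + u.2.2 = x.2.2
  · obtain ⟨h1, h2, h3⟩ := h
    have hx1 := x.1.2
    have hx2 := x.2.1.2
    let w1 : PIdx p := (⟨y.1 + z.1, by omega⟩, ⟨y.2.1 + z.2.1, by omega⟩, y.2.2 + z.2.2)
    let w2 : PIdx p := (⟨z.1 + u.1, by omega⟩, ⟨z.2.1 + u.2.1, by omega⟩, z.2.2 + u.2.2)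
    rw [Finset.sum_eq_single w1, Finset.sum_eq_single w2]
    · have e1 : IsSum y z w1 := ⟨rfl, rfl, rfl⟩
      have e2 : IsSum w1 u x := ⟨h1, h2, h3⟩
      have e3 : IsSum z u w2 := ⟨rfl, rfl, rfl⟩
      have e4 : IsSum y w2 x := ⟨by simp [w2]; omega, by simp [w2]; omega, by
        rw [← h3]; simp [w2]; ring⟩
      rw [sc, sc, sc, sc, if_pos e1, if_pos e2, if_pos e3, if_pos e4, ← qPow_add, ← qPow_add]
      congr 1
      simp only [twist, w1, w2]
      push_cast
      ring
    · intro w _ hw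
      have : ¬ IsSum z u w := fun e => hw (by
        obtain ⟨e1, e2, e3⟩ := e
        exact Prod.ext (Fin.ext e1.symm) (Prod.ext (Fin.ext e2.symm) e3.symm))
      rw [sc, if_neg this, zero_mul]
    · simp
    · intro w _ hw
      have : ¬ IsSum y z w := fun e => hw (by
        obtain ⟨e1, e2, e3⟩ := e
        exact Prod.ext (Fin.ext e1.symm) (Prod.ext (Fin.ext e2.symm) e3.symm))
      rw [sc, if_neg this, zero_mul]
    · simp
  · rw [Finset.sum_eq_zero, Finset.sum_eq_zero]
    · intro w _
      by_cases e : IsSum z u w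
      · have : ¬ IsSum y w x := fun e' => h (by
          obtain ⟨e1, e2, e3⟩ := e
          obtain ⟨f1, f2, f3⟩ := e'
          exact ⟨by omega, by omega, by rw [← f3, ← e3]; ring⟩)
        rw [sc, sc, if_neg this, mul_zero]
      · rw [sc, if_neg e, zero_mul]
    · intro w _
      by_cases e : IsSum y z w
      · have : ¬ IsSum w u x := fun e' => h (by
          obtain ⟨e1, e2, e3⟩ := e
          obtain ⟨f1, f2, f3⟩ := e'
          exact ⟨by omega, by omega, by rw [← f3, ← e3]⟩)
        rw [sc, sc, if_neg this, mul_zero]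
      · rw [sc, if_neg e, zero_mul]

theorem mul_assoc' (f g h : RedPoincare p q) : f * g * h = f * (g * h) := by
  ext x
  have L : (f * g * h).coeff x =
      ∑ y, ∑ z, ∑ u, (∑ w, sc q y z w * sc q w u x) * (f.coeff y * g.coeff z * h.coeff u) := by
    simp only [coeff_mul, Finset.sum_mul, Finset.mul_sum]
    rw [Finset.sum_comm]
    refine (Finset.sum_congr rfl fun u _ => Finset.sum_comm).trans ?_
    refine Finset.sum_comm.trans (Finset.sum_congr rfl fun y _ => ?_)
    refine (Finset.sum_congr rfl fun u _ => Finset.sum_comm).trans ?_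
    refine Finset.sum_comm.trans ?_
    refine Finset.sum_congr rfl fun z _ => Finset.sum_congr rfl fun u _ =>
      Finset.sum_congr rfl fun w _ => ?_
    ring
  have R : (f * (g * h)).coeff x =
      ∑ y, ∑ z, ∑ u, (∑ w, sc q z u w * sc q y w x) * (f.coeff y * g.coeff z * h.coeff u) := by
    simp only [coeff_mul, Finset.sum_mul, Finset.mul_sum]
    refine Finset.sum_congr rfl fun y _ => ?_
    refine Finset.sum_comm.trans (Finset.sum_congr rfl fun z _ => ?_)
    refine Finset.sum_comm.trans (Finset.sum_congr rfl fun u _ => ?_)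
    refine Finset.sum_congr rfl fun w _ => ?_
    ring
  rw [L, R]
  simp only [sc_assoc]

set_option linter.unusedSectionVars false in
theorem mono_mul_coeff (y : PIdx p) (g : RedPoincare p q) (x) :
    (mono p q y * g).coeff x = ∑ z, sc q y z x * g.coeff z := by
  rw [coeff_mul, Finset.sum_eq_single y]
  · simp [coeff_mono]
  · intro w _ hw
    simp [coeff_mono, hw]
  · simp

set_option linter.unusedSectionVars false in
theorem mul_mono_coeff (f : RedPoincare p q) (z : PIdx p) (x) :
    (f * mono p q z).coeff x = ∑ y, sc q y z x * f.coeff y := by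
  rw [coeff_mul]
  refine Finset.sum_congr rfl fun y _ => ?_
  rw [Finset.sum_eq_single z]
  · simp [coeff_mono]
  · intro w _ hw
    simp [coeff_mono, hw]
  · simp

theorem one_mul' (f : RedPoincare p q) : 1 * f = f := by
  ext x
  rw [one_def, mono_mul_coeff, Finset.sum_eq_single x]
  · have : IsSum (0, 0, 0) x x := ⟨by simp, by simp, by simp⟩
    simp [sc, this, twist, qPow_zero]
  · intro w _ hw
    have : ¬ IsSum (0, 0, 0) w x := fun e => hw (by
      obtain ⟨e1, e2, e3⟩ := e
      simp at e1 e2 e3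
      exact Prod.ext (Fin.ext e1) (Prod.ext (Fin.ext e2) e3))
    simp [sc, this]
  · simp

theorem mul_one' (f : RedPoincare p q) : f * 1 = f := by
  ext x
  rw [one_def, mul_mono_coeff, Finset.sum_eq_single x]
  · have : IsSum x (0, 0, 0) x := ⟨by simp, by simp, by simp⟩
    simp [sc, this, twist, qPow_zero]
  · intro w _ hw
    have : ¬ IsSum w (0, 0, 0) x := fun e => hw (by
      obtain ⟨e1, e2, e3⟩ := e
      simp at e1 e2 e3
      exact Prod.ext (Fin.ext e1) (Prod.ext (Fin.ext e2) e3))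
    simp [sc, this]
  · simp

instance : Ring (RedPoincare p q) :=
  { (inferInstance : AddCommGroup (RedPoincare p q)),
    (inferInstance : Mul (RedPoincare p q)),
    (inferInstance : One (RedPoincare p q)) with
    left_distrib := fun f g h => by
      ext x
      simp only [coeff_mul, coeff_add, mul_add, Finset.sum_add_distrib]
    right_distrib := fun f g h => by
      ext x
      simp only [coeff_mul, coeff_add, add_mul, mul_add, Finset.sum_add_distrib]
    zero_mul := fun f => by ext x; simp [coeff_mul]
    mul_zero := fun f => by ext x; simp [coeff_mul]
    mul_assoc := mul_assoc'
    one_mul := one_mul'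
    mul_one := mul_one' }

instance : Algebra ℂ (RedPoincare p q) := Algebra.ofModule
  (fun r f g => by
    ext x
    simp only [coeff_mul, coeff_smul, Finset.mul_sum]
    exact Finset.sum_congr rfl fun y _ => Finset.sum_congr rfl fun z _ => by ring)
  (fun r f g => by
    ext x
    simp only [coeff_mul, coeff_smul, Finset.mul_sum]
    exact Finset.sum_congr rfl fun y _ => Finset.sum_congr rfl fun z _ => by ring)

/-- The exponent of `q` in `(η₊^a η₋^b δ^c)* = q^(2ab - 2c(a+b)) η₊^a η₋^b δ^c`. -/
def starTwist (x : PIdx p) : ZMod p :=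
  2 * (x.1 : ℕ) * (x.2.1 : ℕ) - 2 * x.2.2 * ((x.1 : ℕ) + (x.2.1 : ℕ))

/-- The antilinear antimultiplicative involution with `η±* = η±`, `δ* = δ`. -/
instance : StarRing (RedPoincare p q) where
  star f := fun x => qPow p q (starTwist x) * conj (f.coeff x)
  star_involutive f := by
    ext x
    change qPow p q (starTwist x) * conj (qPow p q (starTwist x) * conj (f.coeff x)) = _
    rw [map_mul, conj_qPow, ← mul_assoc, ← qPow_add, add_neg_cancel, qPow_zero, Complex.conj_conj,
      one_mul]
  star_add f g := by
    ext x
    change qPow p q (starTwist x) * conj ((f + g).coeff x) =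
      qPow p q (starTwist x) * conj (f.coeff x) + qPow p q (starTwist x) * conj (g.coeff x)
    rw [coeff_add, map_add, mul_add]
  star_mul f g := by
    ext x
    change qPow p q (starTwist x) * conj ((f * g).coeff x) =
      ∑ y : PIdx p, ∑ z : PIdx p, sc q y z x *
        ((qPow p q (starTwist y) * conj (g.coeff y)) * (qPow p q (starTwist z) * conj (f.coeff z)))
    rw [Finset.sum_comm]
    simp only [coeff_mul, map_sum, map_mul, Finset.mul_sum]
    refine Finset.sum_congr rfl fun y _ => Finset.sum_congr rfl fun z _ => ?_
    by_cases h : IsSum y z x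
    · have h' : IsSum z y x := by
        obtain ⟨h1, h2, h3⟩ := h
        exact ⟨by omega, by omega, by rw [← h3, add_comm]⟩
      have key : starTwist x + -twist y z = twist z y + starTwist z + starTwist y := by
        obtain ⟨h1, h2, h3⟩ := h
        simp only [starTwist, twist, ← h1, ← h2, ← h3]
        push_cast
        ring
      rw [sc, sc, if_pos h, if_pos h', conj_qPow]
      have key2 := congrArg (qPow p q) key
      simp only [qPow_add] at key2
      linear_combination (conj (f.coeff y) * conj (g.coeff z)) * key2
    · have h' : ¬ IsSum z y x := fun e => h (by
        obtain ⟨h1, h2, h3⟩ := e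
        exact ⟨by omega, by omega, by rw [← h3, add_comm]⟩)
      rw [sc, sc, if_neg h, if_neg h']
      simp

/-- The generator `η₊` (it is `0` if `p = 1`). -/
def etaP : RedPoincare p q := fun x => if (x.1 : ℕ) = 1 ∧ (x.2.1 : ℕ) = 0 ∧ x.2.2 = 0 then 1 else 0

/-- The generator `η₋` (it is `0` if `p = 1`). -/
def etaM : RedPoincare p q := fun x => if (x.1 : ℕ) = 0 ∧ (x.2.1 : ℕ) = 1 ∧ x.2.2 = 0 then 1 else 0

/-- The generator `δ`. -/
def del : RedPoincare p q := mono p q (0, 0, 1)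

/-- The invariant integral
`𝓘(η₊^n η₋^m δ^k) = q⁻¹` if `n = m = p - 1` and `k ≡ 0 mod p`, and `0` otherwise. -/
def invInt : RedPoincare p q →ₗ[ℂ] ℂ where
  toFun f := ∑ x : PIdx p, f.coeff x *
    (if (x.1 : ℕ) = p - 1 ∧ (x.2.1 : ℕ) = p - 1 ∧ x.2.2 = 0 then q⁻¹ else 0)
  map_add' f g := by simp only [coeff_add, add_mul, Finset.sum_add_distrib]
  map_smul' c f := by
    simp only [coeff_smul, Finset.mul_sum, mul_assoc, RingHom.id_apply, smul_eq_mul]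

end ring
end RedPoincare

/-! ### The quantum Poincaré group at a root of unity

Elements of `A(E_q(1,1)) = A(E(1,1|p)) × C^∞(ℝ²)` are finite sums `∑ aₙ fₙ(z₊, z₋)` where `z₊, z₋`
are central and `f(z)* = conj f(z)`. They are written as functions of `z = (z₊, z₋)` with values in
`A(E(1,1|p))`, with pointwise product and involution. -/

namespace QPoincare

variable {p : ℕ} {q : ℂ}

/-- `F` belongs to `A(E_q(1,1))`: the coefficient functions are smooth. -/
def MemA (F : ℝ × ℝ → RedPoincare p q) : Prop :=
  ∀ x, ContDiff ℝ ∞ (fun z => (F z).coeff x)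

/-- `F` belongs to `A₀(E_q(1,1))`: the coefficient functions are smooth with compact support. -/
def MemA₀ (F : ℝ × ℝ → RedPoincare p q) : Prop :=
  ∀ x, ContDiff ℝ ∞ (fun z => (F z).coeff x) ∧ HasCompactSupport (fun z => (F z).coeff x)

section

variable [NeZero p] [hq : Fact (IsPrimitiveRoot q p)]

/-- The invariant integral `I_E(∑ aₙ fₙ) = ∑ 𝓘(aₙ) ∫∫ fₙ(z₊, z₋) dz₊ dz₋`. -/
def intE (F : ℝ × ℝ → RedPoincare p q) : ℂ :=
  ∑ x : PIdx p, RedPoincare.invInt (RedPoincare.mono p q x) * ∫ z : ℝ × ℝ, (F z).coeff x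

/-- The Hermitian form `(F, G)_E = I_E(F G*)`. -/
def formE (F G : ℝ × ℝ → RedPoincare p q) : ℂ := intE (fun z => F z * star (G z))

end

/-! ### The representation in `A(SO(1,1|p))` -/

/-- The algebra `A(SO(1,1|p))` of polynomials in `δ` with `δ ^ p = 1`; `δ ^ m` is `single m 1`. -/
abbrev SOAlg (p : ℕ) : Type := AddMonoidAlgebra ℂ (ZMod p)

/-- The element `δ ^ m` of `A(SO(1,1|p))`. -/
def dlt (m : ZMod p) : SOAlg p := AddMonoidAlgebra.single m 1

/-- The antilinear involution of `A(SO(1,1|p))` with `δ* = δ`. -/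
def starS (a : SOAlg p) : SOAlg p := a.coeff.sum fun m c => conj c • dlt m

/-- The invariant integral `I_S(δ ^ m) = 1` if `m ≡ 0 mod p`, and `0` otherwise. -/
def intS (a : SOAlg p) : ℂ := a.coeff 0

/-- The Hermitian form `(a, b)_S = I_S(a* b)`. -/
def formS (a b : SOAlg p) : ℂ := intS (starS a * b)

/-- The matrix of `L^λ(p₊) : δ ^ m ↦ λ₊ δ ^ (m + 1)` in the basis `δ ^ m`. -/
def Lp (l : ℝ × ℝ) : Matrix (ZMod p) (ZMod p) ℂ :=
  Matrix.of fun j m => if j = m + 1 then (l.1 : ℂ) else 0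

/-- The matrix of `L^λ(p₋) : δ ^ m ↦ λ₋ δ ^ (m - 1)`. -/
def Lm (l : ℝ × ℝ) : Matrix (ZMod p) (ZMod p) ℂ :=
  Matrix.of fun j m => if j = m - 1 then (l.2 : ℂ) else 0

variable (p q) in
/-- The matrix of `L^λ(κ) : δ ^ m ↦ q ^ m δ ^ m`. -/
def Lk : Matrix (ZMod p) (ZMod p) ℂ := Matrix.diagonal fun m => qPow p q m

variable (p q) in
/-- The matrix of `L^λ(κ⁻¹) : δ ^ m ↦ q ^ (-m) δ ^ m`. -/
def LkInv : Matrix (ZMod p) (ZMod p) ℂ := Matrix.diagonal fun m => qPow p q (-m)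

section T

variable [NeZero p] [hq : Fact (IsPrimitiveRoot q p)]

/-- `L ⊗ a`, as a matrix with entries in `A(E(1,1|p))`. -/
def tens (L : Matrix (ZMod p) (ZMod p) ℂ) (a : RedPoincare p q) :
    Matrix (ZMod p) (ZMod p) (RedPoincare p q) := L.map fun c => c • a

variable (q) in
/-- `L^λ(ε₊)`, where `ε₊ = -q^(-1/2) p₊ κ⁻¹` and `s = q^(1/2)`. -/
def Lep (s : ℂ) (l : ℝ × ℝ) : Matrix (ZMod p) (ZMod p) ℂ := (-s⁻¹) • (Lp l * LkInv p q)

variable (q) in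
/-- `L^λ(ε₋)`, where `ε₋ = -q^(1/2) p₋ κ⁻¹` and `s = q^(1/2)`. -/
def Lem (s : ℂ) (l : ℝ × ℝ) : Matrix (ZMod p) (ZMod p) ℂ := (-s) • (Lm l * LkInv p q)

/-- The cut off q-exponential `∑_{m<p} r^(m(m-1)/2) / [m]! x^m`: it is `e₊^x` for `r = q` and
`e₋^x` for `r = q⁻¹`. -/
def cutExp (r : ℂ) (x : Matrix (ZMod p) (ZMod p) (RedPoincare p q)) :
    Matrix (ZMod p) (ZMod p) (RedPoincare p q) :=
  ∑ m ∈ Finset.range p, (r ^ (m * (m - 1) / 2) / qFact q m) • x ^ m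

variable (p q) in
/-- `D(L^λ(κ), δ) = (1/p) ∑_{m,k=0}^{p-1} q^(-mk) L^λ(κ)^m ⊗ δ^k`. -/
def DKap : Matrix (ZMod p) (ZMod p) (RedPoincare p q) :=
  (1 / (p : ℂ)) • ∑ m ∈ Finset.range p, ∑ k ∈ Finset.range p,
    (q⁻¹ ^ (m * k)) • tens (Lk p q ^ m) (RedPoincare.del ^ k)

variable (q) in
/-- The value at `z = (z₊, z₋)` of
`T^λ = e^(-i L(P₊) ⊗ z₊ - i L(P₋) ⊗ z₋) e₊^(i L(ε₊) ⊗ η₊) e₋^(i L(ε₋) ⊗ η₋) D(L(κ), δ)`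
with `P± = p±^p`, as a matrix in the basis `δ ^ m`: `T^λ δ^n = ∑_j δ^j ⊗ T_{jn}`. -/
def T (s : ℂ) (l z : ℝ × ℝ) : Matrix (ZMod p) (ZMod p) (RedPoincare p q) :=
  tens (NormedSpace.exp ((-Complex.I * z.1) • (Lp l : Matrix (ZMod p) (ZMod p) ℂ) ^ p +
      (-Complex.I * z.2) • (Lm l : Matrix (ZMod p) (ZMod p) ℂ) ^ p)) 1 *
    cutExp q (tens (Complex.I • Lep q s l) RedPoincare.etaP) *
    cutExp q⁻¹ (tens (Complex.I • Lem q s l) RedPoincare.etaM) *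
    DKap p q

/-- The form `{a ⊗ F, b ⊗ G}_S = F* G (a, b)_S` on elements `∑_j δ^j ⊗ X_j`, `∑_k δ^k ⊗ Y_k`. -/
def formSA (X Y : ZMod p → RedPoincare p q) : RedPoincare p q :=
  ∑ j : ZMod p, ∑ k : ZMod p, formS (dlt j) (dlt k) • (star (X j) * Y k)

variable (q) in
/-- The matrix element `D^λ_{mn} = {δ^(p-m) ⊗ 1, T^λ δ^n}_S`, as a function of `z = (z₊, z₋)`. -/
def D (s : ℂ) (l : ℝ × ℝ) (m n : ZMod p) (z : ℝ × ℝ) : RedPoincare p q :=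
  formSA (Pi.single ((p : ZMod p) - m) 1) (fun j => T q s l z j n)

/-- The cut off element `χ(z / R) F`. -/
def cutoff (χ : ℝ × ℝ → ℂ) (R : ℝ) (F : ℝ × ℝ → RedPoincare p q) : ℝ × ℝ → RedPoincare p q :=
  fun z => χ (R⁻¹ • z) • F z

end T

/-- The normalization constant `Λ = (2π)² / p² ∑_{k=0}^{p-1} 1 / ([k]! [p-1-k]!)²`. -/
def Lam (p : ℕ) (q : ℂ) : ℂ :=
  (2 * (Real.pi : ℂ)) ^ 2 / (p : ℂ) ^ 2 *
    ∑ k ∈ Finset.range p, 1 / (qFact q k * qFact q (p - 1 - k)) ^ 2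

end QPoincare

end

/-!
The factor `D(L(κ), δ)` fixes `δ^0`, the operators `P±` are scalars, and the two q-exponentials are
polynomials in weighted shifts. Hence `D^l_{n0}` is the plane wave `exp(-i (z₊ l₊^p + z₋ l₋^p))` times
a sum over `a - b ≡ n` of explicit multiples of `l₊^a l₋^b η₊^a η₋^b` (`T_apply_zero`, `D_eq`). The
invariant integral of `D^l_{n0} (D^l'_{m0})*` only sees products of complementary monomials, with
exponents `(a, b)` and `(p-1-a, p-1-b)`, which forces `n + m ≡ 0`. All phases and powers of `q`
cancel (`matCoeff_compl_mul`), and `[k]! [p-1-k]! = (-1)^k [p-1]!` makes the `p` surviving terms equal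
in weight. Each term is `l₊^a l'₊^(p-1-a) l₋^b l'₋^(p-1-b)` times `R² K(R (l^p - l'^p))`, where `K` is
the Fourier integral of `|χ|²` and powers are taken in each coordinate (`formE_cutoff_D`).

It remains to see that each of these kernels tends to `(∫ K) / p²` times the delta distribution on
the diagonal (`tendsto_integral_pair_kernel`). For fixed `l` off the coordinate axes, the
substitution `u = l'^p`, a homeomorphism because `p` is odd, turns the integral over `l'` into an
approximate identity applied to an integrable density that is continuous at `l^p`; on the diagonal
the monomial cancels the Jacobian `p² l₊^(p-1) l₋^(p-1)` up to `p²`. Near the axes the Jacobian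
degenerates, but the integrals over `l'` are bounded uniformly in `R` and `l`
(`integral_monomial_kernel_le`), so dominated convergence applies to the integral over `l`. Finally
`∫ K = (2π)² |χ(0)|²` by Fourier inversion (`integral_planeFourier`).
-/

noncomputable section

/-! ### Approximate identities in the plane -/

/-- The decaying weight `(1 + u²)⁻²` on the line. -/
def invSqWeight (u : ℝ) : ℝ := ((1 + u ^ 2)⁻¹) ^ 2

/-- The product weight `(1 + u₁²)⁻² (1 + u₂²)⁻²` on the plane. -/
def planeWeight (u : ℝ × ℝ) : ℝ := invSqWeight u.1 * invSqWeight u.2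

theorem invSqWeight_pos (u : ℝ) : 0 < invSqWeight u := by unfold invSqWeight; positivity

theorem invSqWeight_le_inv (u : ℝ) : invSqWeight u ≤ (1 + u ^ 2)⁻¹ := by
  have h : (1 + u ^ 2)⁻¹ ≤ 1 := inv_le_one_of_one_le₀ (by nlinarith [sq_nonneg u])
  have h0 : 0 ≤ (1 + u ^ 2)⁻¹ := by positivity
  unfold invSqWeight
  nlinarith

theorem continuous_invSqWeight : Continuous invSqWeight := by
  unfold invSqWeight
  exact (Continuous.inv₀ (by fun_prop) fun u => by positivity).pow 2

theorem integrable_invSqWeight : Integrable invSqWeight :=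
  integrable_inv_one_add_sq.mono' continuous_invSqWeight.aestronglyMeasurable
    (Eventually.of_forall fun u => by
      rw [Real.norm_of_nonneg (invSqWeight_pos u).le]; exact invSqWeight_le_inv u)

theorem planeWeight_pos (u : ℝ × ℝ) : 0 < planeWeight u :=
  mul_pos (invSqWeight_pos _) (invSqWeight_pos _)

theorem continuous_planeWeight : Continuous planeWeight := by
  have := continuous_invSqWeight
  unfold planeWeight
  fun_prop

theorem integrable_planeWeight : Integrable planeWeight :=
  integrable_invSqWeight.mul_prod integrable_invSqWeight

theorem integral_planeWeight_pos : 0 < ∫ u, planeWeight u := by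
  rw [integral_pos_iff_support_of_nonneg (fun u => (planeWeight_pos u).le) integrable_planeWeight,
    Function.support_eq_univ fun u => (planeWeight_pos u).ne']
  exact Measure.measure_univ_pos.2 (NeZero.ne _)

theorem planeWeight_le_one (u : ℝ × ℝ) : planeWeight u ≤ 1 := by
  have h : ∀ v, invSqWeight v ≤ 1 := fun v =>
    (invSqWeight_le_inv v).trans (inv_le_one_of_one_le₀ (by nlinarith [sq_nonneg v]))
  exact mul_le_one₀ (h _) (invSqWeight_pos _).le (h _)

theorem integrable_scaled_kernel_mul {f : ℝ × ℝ → ℝ} {c : ℝ} (hf : Continuous f)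
    (hc : ∀ u, |f u| ≤ c * planeWeight u) {g : ℝ × ℝ → ℂ} (hg : Integrable g) (x : ℝ × ℝ) (R : ℝ) :
    Integrable fun u => (R ^ 2 * f (R • (x - u)) : ℂ) * g u := by
  have hc0 : 0 ≤ c := nonneg_of_mul_nonneg_left ((abs_nonneg _).trans (hc 0)) (planeWeight_pos 0)
  refine hg.bdd_mul (c := R ^ 2 * c) (Continuous.aestronglyMeasurable (by fun_prop))
    (Eventually.of_forall fun u => ?_)
  rw [norm_mul, norm_pow, Complex.norm_real, Complex.norm_real, Real.norm_eq_abs, sq_abs]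
  gcongr
  exact (hc _).trans (mul_le_of_le_one_right hc0 (planeWeight_le_one _))

/-- The weight decays faster than `‖u‖⁻²`, as approximate identities in the plane require. -/
theorem norm_sq_mul_planeWeight_le (u : ℝ × ℝ) : ‖u‖ ^ 2 * planeWeight u ≤ (1 + ‖u‖ ^ 2)⁻¹ := by
  have h : 1 + ‖u‖ ^ 2 ≤ (1 + u.1 ^ 2) * (1 + u.2 ^ 2) := by
    rw [Prod.norm_def, Real.norm_eq_abs, Real.norm_eq_abs]
    rcases max_choice |u.1| |u.2| with h | h <;> rw [h, sq_abs] <;>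
      nlinarith [mul_nonneg (sq_nonneg u.1) (sq_nonneg u.2), sq_nonneg u.1, sq_nonneg u.2]
  have e : planeWeight u = (((1 + u.1 ^ 2) * (1 + u.2 ^ 2))⁻¹) ^ 2 := by
    rw [planeWeight, invSqWeight, invSqWeight, mul_inv, mul_pow]
  have h1 : ((1 + u.1 ^ 2) * (1 + u.2 ^ 2))⁻¹ ≤ (1 + ‖u‖ ^ 2)⁻¹ :=
    inv_anti₀ (by positivity) h
  rw [e]
  calc ‖u‖ ^ 2 * (((1 + u.1 ^ 2) * (1 + u.2 ^ 2))⁻¹) ^ 2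
      ≤ (1 + ‖u‖ ^ 2) * ((1 + ‖u‖ ^ 2)⁻¹) ^ 2 := by gcongr; linarith
    _ = (1 + ‖u‖ ^ 2)⁻¹ := by field_simp

theorem tendsto_norm_sq_mul_of_le_planeWeight {k : ℝ × ℝ → ℝ} {C : ℝ} (hk : ∀ u, 0 ≤ k u)
    (hC : ∀ u, k u ≤ C * planeWeight u) :
    Tendsto (fun u => ‖u‖ ^ 2 * k u) (Bornology.cobounded (ℝ × ℝ)) (𝓝 0) := by
  have h1 : Tendsto (fun u : ℝ × ℝ => C * (1 + ‖u‖ ^ 2)⁻¹) (Bornology.cobounded (ℝ × ℝ)) (𝓝 0) := by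
    rw [← mul_zero C]
    refine Tendsto.const_mul _ (tendsto_inv_atTop_zero.comp ?_)
    exact tendsto_atTop_add_const_left _ _
      ((tendsto_pow_atTop two_ne_zero).comp tendsto_norm_cobounded_atTop)
  have hC0 : 0 ≤ C := by
    have := (hk 0).trans (hC 0)
    exact nonneg_of_mul_nonneg_left this (planeWeight_pos 0)
  refine squeeze_zero (fun u => mul_nonneg (by positivity) (hk u)) (fun u => ?_) h1
  calc ‖u‖ ^ 2 * k u ≤ ‖u‖ ^ 2 * (C * planeWeight u) := by gcongr; exact hC u
    _ = C * (‖u‖ ^ 2 * planeWeight u) := by ring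
    _ ≤ _ := by gcongr; exact norm_sq_mul_planeWeight_le u

/-- Approximate identities from a nonnegative kernel of arbitrary positive mass. -/
theorem tendsto_integral_peak_of_nonneg {k : ℝ × ℝ → ℝ} {C : ℝ} (hk : ∀ u, 0 ≤ k u)
    (hC : ∀ u, k u ≤ C * planeWeight u) (hpos : 0 < ∫ u, k u) {g : ℝ × ℝ → ℂ} {x : ℝ × ℝ}
    (hg : Integrable g) (hgx : ContinuousAt g x) :
    Tendsto (fun R : ℝ => ∫ u, (R ^ 2 * k (R • (x - u)) : ℂ) * g u) atTop
      (𝓝 ((∫ u, k u : ℝ) * g x)) := by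
  set I := ∫ u, k u with hI
  have key := tendsto_integral_comp_smul_smul_of_integrable' (μ := (volume : Measure (ℝ × ℝ)))
    (φ := fun u => I⁻¹ * k u) (x₀ := x) (fun u => mul_nonneg (inv_nonneg.2 hpos.le) (hk u))
    (by rw [integral_const_mul, ← hI, inv_mul_cancel₀ hpos.ne'])
    (by
      have := (tendsto_norm_sq_mul_of_le_planeWeight hk hC).const_mul I⁻¹
      rw [mul_zero] at this
      refine this.congr fun u => ?_
      rw [Module.finrank_prod, Module.finrank_self]
      ring) hg hgx
  refine (key.const_mul (I : ℂ)).congr fun R => ?_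
  rw [← integral_const_mul]
  refine integral_congr_ae (Eventually.of_forall fun u => ?_)
  have hI0 : (I : ℂ) ≠ 0 := by exact_mod_cast hpos.ne'
  simp only [Module.finrank_prod, Module.finrank_self, Complex.real_smul]
  push_cast
  field_simp

/-- Approximate identities from a complex kernel: its real and imaginary parts become nonnegative
after adding a multiple of the weight that dominates it. -/
theorem tendsto_integral_peak {K : ℝ × ℝ → ℂ} {C : ℝ} (hKc : Continuous K)
    (hC : ∀ u, ‖K u‖ ≤ C * planeWeight u) {g : ℝ × ℝ → ℂ} {x : ℝ × ℝ}
    (hg : Integrable g) (hgx : ContinuousAt g x) :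
    Tendsto (fun R : ℝ => ∫ u, ((R : ℂ) ^ 2 * K (R • (x - u))) * g u) atTop
      (𝓝 ((∫ u, K u) * g x)) := by
  have hC0 : 0 ≤ C := nonneg_of_mul_nonneg_left ((norm_nonneg _).trans (hC 0)) (planeWeight_pos 0)
  have hKi : Integrable K := (integrable_planeWeight.const_mul C).mono' hKc.aestronglyMeasurable
    (Eventually.of_forall hC)
  have hw := integral_planeWeight_pos
  have hcw := continuous_planeWeight
  -- each real part `r` of the kernel is treated as `(r + (C + 1) w) - (C + 1) w`
  have real_case : ∀ r : ℝ × ℝ → ℝ, Continuous r → Integrable r →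
      (∀ u, |r u| ≤ C * planeWeight u) →
      Tendsto (fun R : ℝ => ∫ u, (R ^ 2 * r (R • (x - u)) : ℂ) * g u) atTop
        (𝓝 ((∫ u, r u : ℝ) * g x)) := by
    intro r hrc hri hr
    have hri' : Integrable fun u => r u + (C + 1) * planeWeight u :=
      hri.add (integrable_planeWeight.const_mul _)
    have h1 := tendsto_integral_peak_of_nonneg (k := fun u => r u + (C + 1) * planeWeight u)
      (C := 2 * C + 1) (fun u => by have := neg_abs_le (r u); nlinarith [hr u, planeWeight_pos u])
      (fun u => by have := le_abs_self (r u); nlinarith [hr u])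
      (lt_of_lt_of_le hw (integral_mono integrable_planeWeight hri' fun u => by
        have := neg_abs_le (r u)
        show planeWeight u ≤ r u + (C + 1) * planeWeight u
        nlinarith [hr u])) hg hgx
    have h2 := tendsto_integral_peak_of_nonneg (k := fun u => (C + 1) * planeWeight u)
      (C := C + 1) (fun u => by have := planeWeight_pos u; positivity)
      (fun u => le_rfl) (by rw [integral_const_mul]; positivity) hg hgx
    have h3 := h1.sub h2
    rw [← sub_mul, ← Complex.ofReal_sub, ← integral_sub hri' (integrable_planeWeight.const_mul _)]
      at h3
    simp only [add_sub_cancel_right] at h3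
    refine h3.congr fun R => ?_
    have i1 := integrable_scaled_kernel_mul (f := fun u => r u + (C + 1) * planeWeight u)
      (c := 2 * C + 1) (by fun_prop) (fun u => by
        rw [abs_le]
        have h4 := abs_le.1 (hr u)
        have h5 := planeWeight_pos u
        constructor <;> nlinarith) hg x R
    have i2 := integrable_scaled_kernel_mul (f := fun u => (C + 1) * planeWeight u)
      (c := C + 1) (by fun_prop) (fun u => by
        rw [abs_of_pos (mul_pos (by linarith) (planeWeight_pos u))]) hg x R
    rw [← integral_sub i1 i2]
    refine integral_congr_ae (Eventually.of_forall fun u => ?_)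
    simp only
    push_cast
    ring
  have hre := real_case (fun u => (K u).re) (by fun_prop) hKi.re
    fun u => (Complex.abs_re_le_norm _).trans (hC u)
  have him := real_case (fun u => (K u).im) (by fun_prop) hKi.im
    fun u => (Complex.abs_im_le_norm _).trans (hC u)
  have h := hre.add (him.const_mul Complex.I)
  have e : ((∫ u, (K u).re : ℝ) : ℂ) * g x + Complex.I * ((∫ u, (K u).im : ℝ) * g x) =
      (∫ u, K u) * g x := by
    rw [← integral_re_add_im hKi]
    simp only [RCLike.re_to_complex, RCLike.im_to_complex, RCLike.I_to_complex, Complex.coe_algebraMap]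
    ring
  rw [e] at h
  refine h.congr fun R => ?_
  rw [← integral_const_mul, ← integral_add
    (integrable_scaled_kernel_mul (by fun_prop)
      (fun u => (Complex.abs_re_le_norm _).trans (hC u)) hg x R)
    ((integrable_scaled_kernel_mul (by fun_prop)
      (fun u => (Complex.abs_im_le_norm _).trans (hC u)) hg x R).const_mul _)]
  refine integral_congr_ae (Eventually.of_forall fun u => ?_)
  simp only
  conv_rhs => rw [← Complex.re_add_im (K (R • (x - u)))]
  ring

/-! ### The power substitution -/

/-- The odd power map `y ↦ y ^ p` as a homeomorphism of the line. -/
def oddPowHomeomorph {p : ℕ} (hp : Odd p) : ℝ ≃ₜ ℝ :=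
  (hp.strictMono_pow.orderIsoOfSurjective (fun y : ℝ => y ^ p) (by
    have h : ∀ x : ℝ, 0 ≤ x → (x ^ ((p : ℝ)⁻¹)) ^ p = x := fun x hx =>
      Real.rpow_inv_natCast_pow hx hp.pos.ne'
    intro x
    rcases le_total 0 x with hx | hx
    · exact ⟨_, h x hx⟩
    · exact ⟨-((-x) ^ ((p : ℝ)⁻¹)), by
        simp only [hp.neg_pow, h (-x) (by linarith), neg_neg]⟩)).toHomeomorph

theorem oddPowHomeomorph_apply {p : ℕ} (hp : Odd p) (y : ℝ) : oddPowHomeomorph hp y = y ^ p := rfl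

/-- The map `(y₁, y₂) ↦ (y₁ ^ p, y₂ ^ p)`. -/
def powPair (p : ℕ) (y : ℝ × ℝ) : ℝ × ℝ := (y.1 ^ p, y.2 ^ p)

theorem continuous_powPair (p : ℕ) : Continuous (powPair p) := by unfold powPair; fun_prop

/-- The Jacobian determinant of `powPair p`. -/
def powPairJac (p : ℕ) (y : ℝ × ℝ) : ℝ := (p * y.1 ^ (p - 1)) * (p * y.2 ^ (p - 1))

theorem continuous_powPairJac (p : ℕ) : Continuous (powPairJac p) := by unfold powPairJac; fun_prop

theorem powPairJac_ne_zero {p : ℕ} (hp : p ≠ 0) {y : ℝ × ℝ} (h1 : y.1 ≠ 0) (h2 : y.2 ≠ 0) :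
    powPairJac p y ≠ 0 := by
  unfold powPairJac; positivity

theorem ae_coord_ne_zero : ∀ᵐ y : ℝ × ℝ, y.1 ≠ 0 ∧ y.2 ≠ 0 := by
  have h : ∀ᵐ t : ℝ, t ≠ 0 := Measure.ae_ne volume 0
  exact (Measure.quasiMeasurePreserving_fst.ae h).and (Measure.quasiMeasurePreserving_snd.ae h)

/-- The inverse of `powPair p`. -/
def rootPair {p : ℕ} (hp : Odd p) (u : ℝ × ℝ) : ℝ × ℝ :=
  ((oddPowHomeomorph hp).symm u.1, (oddPowHomeomorph hp).symm u.2)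

theorem continuous_rootPair {p : ℕ} (hp : Odd p) : Continuous (rootPair hp) := by
  unfold rootPair; fun_prop

theorem rootPair_powPair {p : ℕ} (hp : Odd p) (y : ℝ × ℝ) : rootPair hp (powPair p y) = y := by
  simp only [rootPair, powPair, ← oddPowHomeomorph_apply hp, Homeomorph.symm_apply_apply]

theorem powPair_rootPair {p : ℕ} (hp : Odd p) (y : ℝ × ℝ) : powPair p (rootPair hp y) = y := by
  simp only [rootPair, powPair, ← oddPowHomeomorph_apply hp, Homeomorph.apply_symm_apply]

theorem hasFDerivAt_powPair (p : ℕ) (y : ℝ × ℝ) :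
    HasFDerivAt (powPair p)
      ((ContinuousLinearMap.toSpanSingleton ℝ (p * y.1 ^ (p - 1))).prodMap
        (ContinuousLinearMap.toSpanSingleton ℝ (p * y.2 ^ (p - 1)))) y :=
  HasFDerivAt.prodMap (f := fun t : ℝ => t ^ p) (f₂ := fun t : ℝ => t ^ p) y
    (hasDerivAt_pow p y.1).hasFDerivAt (hasDerivAt_pow p y.2).hasFDerivAt

theorem det_powPair_deriv (p : ℕ) (y : ℝ × ℝ) :
    ((ContinuousLinearMap.toSpanSingleton ℝ (p * y.1 ^ (p - 1))).prodMap
        (ContinuousLinearMap.toSpanSingleton ℝ (p * y.2 ^ (p - 1)))).det = powPairJac p y := by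
  rw [ContinuousLinearMap.det, ContinuousLinearMap.coe_prodMap, LinearMap.det_prodMap]
  have h : ∀ c : ℝ, LinearMap.det (ContinuousLinearMap.toSpanSingleton ℝ c : ℝ →ₗ[ℝ] ℝ) = c :=
    fun c => by
      have := ContinuousLinearMap.det_toSpanSingleton (𝕜 := ℝ) c
      rwa [ContinuousLinearMap.det] at this
  rw [h, h, powPairJac]

theorem integral_powPair {p : ℕ} (hp : Odd p) (f : ℝ × ℝ → ℂ) :
    ∫ u, f u = ∫ y, |powPairJac p y| • f (powPair p y) := by
  have h := integral_image_eq_integral_abs_det_fderiv_smul volume MeasurableSet.univ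
    (fun y _ => (hasFDerivAt_powPair p y).hasFDerivWithinAt)
    (Function.LeftInverse.injective (rootPair_powPair hp)).injOn f
  rw [Set.image_univ_of_surjective (Function.RightInverse.surjective (powPair_rootPair hp))] at h
  simpa only [setIntegral_univ, det_powPair_deriv] using h

theorem integrable_powPair_iff {p : ℕ} (hp : Odd p) (f : ℝ × ℝ → ℂ) :
    Integrable f ↔ Integrable fun y => |powPairJac p y| • f (powPair p y) := by
  have h := integrableOn_image_iff_integrableOn_abs_det_fderiv_smul volume MeasurableSet.univ
    (fun y _ => (hasFDerivAt_powPair p y).hasFDerivWithinAt)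
    (Function.LeftInverse.injective (rootPair_powPair hp)).injOn f
  rw [Set.image_univ_of_surjective (Function.RightInverse.surjective (powPair_rootPair hp))] at h
  simpa only [integrableOn_univ, det_powPair_deriv] using h

/-- Off the coordinate axes the scaled kernel `R² K(R (lᵖ - yᵖ))` concentrates at `y = l`, with the
inverse Jacobian of the power map as weight. The density `f / |J|` in the variable `u = yᵖ` is
singular on the axes but integrable, and continuous at `lᵖ`. -/
theorem tendsto_integral_power_kernel {p : ℕ} (hp : Odd p) {K : ℝ × ℝ → ℂ} {C : ℝ}
    (hKc : Continuous K) (hC : ∀ u, ‖K u‖ ≤ C * planeWeight u) {f : ℝ × ℝ → ℂ}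
    (hf : Continuous f) (hfi : Integrable f) {l : ℝ × ℝ} (h1 : l.1 ≠ 0) (h2 : l.2 ≠ 0) :
    Tendsto (fun R : ℝ => ∫ y, ((R : ℂ) ^ 2 * K (R • (powPair p l - powPair p y))) * f y) atTop
      (𝓝 ((∫ u, K u) * (f l / |powPairJac p l|))) := by
  have hJ : ∀ᵐ y : ℝ × ℝ, ((|powPairJac p y| : ℝ) : ℂ) ≠ 0 := by
    filter_upwards [ae_coord_ne_zero] with y hy
    exact_mod_cast abs_ne_zero.2 (powPairJac_ne_zero hp.pos.ne' hy.1 hy.2)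
  set G : ℝ × ℝ → ℂ := fun y => f y / |powPairJac p y|
  have hGi : Integrable fun u => G (rootPair hp u) := by
    rw [integrable_powPair_iff hp]
    refine hfi.congr ?_
    filter_upwards [hJ] with y hy
    rw [rootPair_powPair, Complex.real_smul, mul_div_cancel₀ _ hy]
  have hGc : ContinuousAt (fun u => G (rootPair hp u)) (powPair p l) := by
    have : ContinuousAt G l := hf.continuousAt.div
      (Complex.continuous_ofReal.comp (continuous_powPairJac p).abs).continuousAt
      (by exact_mod_cast abs_ne_zero.2 (powPairJac_ne_zero hp.pos.ne' h1 h2))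
    rw [← rootPair_powPair hp l] at this
    exact ContinuousAt.comp (f := rootPair hp) this (continuous_rootPair hp).continuousAt
  have h := tendsto_integral_peak hKc hC hGi hGc
  simp only [rootPair_powPair] at h
  refine h.congr fun R => ?_
  rw [integral_powPair hp]
  refine integral_congr_ae ?_
  filter_upwards [hJ] with y hy
  rw [rootPair_powPair, Complex.real_smul]
  simp only [G]
  field_simp

/-! ### A uniform bound on the line -/

theorem image_odd_pow_univ {p : ℕ} (hp : Odd p) : (fun y : ℝ => y ^ p) '' Set.univ = Set.univ :=
  Set.image_univ_of_surjective (oddPowHomeomorph hp).surjective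

theorem integrable_odd_pow {p : ℕ} (hp : Odd p) {f : ℝ → ℝ} (hf : Integrable f) :
    Integrable fun y : ℝ => |p * y ^ (p - 1)| * f (y ^ p) := by
  have h := integrableOn_image_iff_integrableOn_abs_deriv_smul (f := fun y : ℝ => y ^ p)
    MeasurableSet.univ (fun y _ => (hasDerivAt_pow p y).hasDerivWithinAt)
    (oddPowHomeomorph hp).injective.injOn f
  rw [image_odd_pow_univ hp] at h
  simp only [integrableOn_univ, smul_eq_mul] at h
  exact h.1 hf

theorem integral_odd_pow {p : ℕ} (hp : Odd p) (f : ℝ → ℝ) :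
    ∫ y : ℝ, |p * y ^ (p - 1)| * f (y ^ p) = ∫ u, f u := by
  have h := integral_image_eq_integral_abs_deriv_smul (f := fun y : ℝ => y ^ p)
    MeasurableSet.univ (fun y _ => (hasDerivAt_pow p y).hasDerivWithinAt)
    (oddPowHomeomorph hp).injective.injOn f
  rw [image_odd_pow_univ hp] at h
  simpa only [setIntegral_univ, smul_eq_mul] using h.symm

/-- For `|y|` at least `|x| / 2` the monomial is comparable to the Jacobian `p |y| ^ (p - 1)`; for
smaller `|y|` the argument of the weight is at least `R |x| ^ p / 2`. -/
theorem monomial_kernel_le {p a : ℕ} (hp : Odd p) (ha : a < p) {R : ℝ} (hR : 0 < R) (x y : ℝ) :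
    |x| ^ a * |y| ^ (p - 1 - a) * (R * invSqWeight (R * (x ^ p - y ^ p))) ≤
      2 ^ p * (|p * y ^ (p - 1)| * (R * invSqWeight (R * (x ^ p - y ^ p)))) +
      (Set.Icc (-|x|) |x|).indicator
        (fun _ => |x| ^ (p - 1) * (R * (1 / 2 + R * |x| ^ p / 2)⁻¹)) y := by
  have hp0 := hp.pos
  have hw := invSqWeight_pos (R * (x ^ p - y ^ p))
  rcases le_or_gt |x| (2 * |y|) with h | h
  · have h1 : |x| ^ a * |y| ^ (p - 1 - a) ≤ 2 ^ p * |p * y ^ (p - 1)| := by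
      calc |x| ^ a * |y| ^ (p - 1 - a) ≤ (2 * |y|) ^ a * |y| ^ (p - 1 - a) := by gcongr
        _ = 2 ^ a * (1 * |y| ^ (p - 1)) := by
          rw [mul_pow, mul_assoc, ← pow_add, one_mul, Nat.add_sub_cancel' (by omega)]
        _ ≤ 2 ^ p * (p * |y| ^ (p - 1)) := by
          gcongr
          · norm_num
          · exact_mod_cast hp0
        _ = _ := by rw [abs_mul, abs_pow, Nat.abs_cast]
    have h2 : 0 ≤ (Set.Icc (-|x|) |x|).indicator
        (fun _ => |x| ^ (p - 1) * (R * (1 / 2 + R * |x| ^ p / 2)⁻¹)) y :=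
      Set.indicator_nonneg (fun _ _ => by positivity) y
    rw [← mul_assoc (2 ^ p)]
    have := mul_le_mul_of_nonneg_right h1 (mul_pos hR hw).le
    linarith
  · have hyx : |y| ≤ |x| := by linarith [abs_nonneg y]
    rw [Set.indicator_of_mem (Set.mem_Icc.2 (abs_le.1 hyx))]
    have h1 : |x| ^ a * |y| ^ (p - 1 - a) ≤ |x| ^ (p - 1) := by
      calc |x| ^ a * |y| ^ (p - 1 - a) ≤ |x| ^ a * |x| ^ (p - 1 - a) := by gcongr
        _ = _ := by rw [← pow_add, Nat.add_sub_cancel' (by omega)]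
    have h2 : |y| ^ p ≤ |x| ^ p / 2 := by
      calc |y| ^ p ≤ (|x| / 2) ^ p := by gcongr; linarith
        _ = |x| ^ p * (1 / 2) ^ p := by ring
        _ ≤ |x| ^ p * (1 / 2) ^ 1 := by
          gcongr ?_ * ?_
          exact pow_le_pow_of_le_one (by norm_num) (by norm_num) hp0
        _ = _ := by ring
    have h3 : |x| ^ p / 2 ≤ |x ^ p - y ^ p| := by
      have := abs_sub_abs_le_abs_sub (x ^ p) (y ^ p)
      rw [abs_pow, abs_pow] at this
      linarith
    have h4 : R * |x| ^ p / 2 ≤ |R * (x ^ p - y ^ p)| := by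
      rw [abs_mul, abs_of_pos hR]; nlinarith
    -- `1 + v² ≥ 3 / 4 + v` turns the quadratic decay into the linear one that the volume of
    -- `|y| ≤ |x|` requires
    have h5 : invSqWeight (R * (x ^ p - y ^ p)) ≤ (1 / 2 + R * |x| ^ p / 2)⁻¹ := by
      refine (invSqWeight_le_inv _).trans (inv_anti₀ (by positivity) ?_)
      rw [← sq_abs]
      nlinarith [sq_nonneg (|R * (x ^ p - y ^ p)| - 1 / 2)]
    have h6 : 0 ≤ 2 ^ p * (|p * y ^ (p - 1)| * (R * invSqWeight (R * (x ^ p - y ^ p)))) := by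
      positivity
    have : |x| ^ a * |y| ^ (p - 1 - a) * (R * invSqWeight (R * (x ^ p - y ^ p))) ≤
        |x| ^ (p - 1) * (R * (1 / 2 + R * |x| ^ p / 2)⁻¹) := by gcongr
    linarith

theorem integrable_scaled_invSqWeight {R : ℝ} (hR : 0 < R) (c : ℝ) :
    Integrable fun u => R * invSqWeight (R * (c - u)) :=
  ((integrable_invSqWeight.comp_mul_left' hR.ne').comp_sub_left c).const_mul R

theorem integral_scaled_invSqWeight {R : ℝ} (hR : 0 < R) (c : ℝ) :
    ∫ u, R * invSqWeight (R * (c - u)) = ∫ u, invSqWeight u := by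
  rw [integral_const_mul, integral_sub_left_eq_self (fun u => invSqWeight (R * u)) volume c,
    Measure.integral_comp_mul_left, abs_of_pos (inv_pos.2 hR), smul_eq_mul,
    mul_inv_cancel_left₀ hR.ne']

/-- A constant that bounds the one-dimensional kernel integrals uniformly in the scale and in the
point. -/
def monomialKernelBound (p : ℕ) : ℝ := 2 ^ p * (∫ u, invSqWeight u) + 4

theorem integrable_monomial_kernel_majorant {p : ℕ} (hp : Odd p) {R : ℝ} (hR : 0 < R) (x : ℝ) :
    Integrable fun y : ℝ =>
      2 ^ p * (|p * y ^ (p - 1)| * (R * invSqWeight (R * (x ^ p - y ^ p)))) +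
      (Set.Icc (-|x|) |x|).indicator
        (fun _ => |x| ^ (p - 1) * (R * (1 / 2 + R * |x| ^ p / 2)⁻¹)) y :=
  ((integrable_odd_pow hp (integrable_scaled_invSqWeight hR (x ^ p))).const_mul _).add
    ((integrable_indicator_iff measurableSet_Icc).2 (integrableOn_const (by simp)))

theorem integrable_monomial_kernel {p a : ℕ} (hp : Odd p) (ha : a < p) {R : ℝ} (hR : 0 < R)
    (x : ℝ) : Integrable fun y : ℝ =>
      |x| ^ a * |y| ^ (p - 1 - a) * (R * invSqWeight (R * (x ^ p - y ^ p))) := by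
  have := continuous_invSqWeight
  refine (integrable_monomial_kernel_majorant hp hR x).mono'
    (Continuous.aestronglyMeasurable (by fun_prop)) (Eventually.of_forall fun y => ?_)
  rw [Real.norm_of_nonneg (by have := invSqWeight_pos (R * (x ^ p - y ^ p)); positivity)]
  exact monomial_kernel_le hp ha hR x y

/-- The bound is uniform in the scale `R` and in the point `x`, although the monomial weight
concentrates near `x = 0` as `R` grows. -/
theorem integral_monomial_kernel_le {p a : ℕ} (hp : Odd p) (ha : a < p) {R : ℝ} (hR : 0 < R)
    (x : ℝ) : ∫ y : ℝ, |x| ^ a * |y| ^ (p - 1 - a) * (R * invSqWeight (R * (x ^ p - y ^ p))) ≤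
      monomialKernelBound p := by
  refine (integral_mono (integrable_monomial_kernel hp ha hR x)
    (integrable_monomial_kernel_majorant hp hR x) (monomial_kernel_le hp ha hR x)).trans ?_
  rw [integral_add
    ((integrable_odd_pow hp (integrable_scaled_invSqWeight hR (x ^ p))).const_mul _)
    ((integrable_indicator_iff measurableSet_Icc).2 (integrableOn_const (by simp))),
    integral_const_mul, integral_odd_pow hp (fun u => R * invSqWeight (R * (x ^ p - u))),
    integral_scaled_invSqWeight hR, integral_indicator measurableSet_Icc, setIntegral_const,
    monomialKernelBound]
  gcongr
  rw [Measure.real, Real.volume_Icc, ENNReal.toReal_ofReal (by linarith [abs_nonneg x]), smul_eq_mul]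
  have hx : |x| * |x| ^ (p - 1) = |x| ^ p := by
    rw [← pow_succ', Nat.sub_add_cancel hp.pos]
  have h0 : 0 < 1 / 2 + R * |x| ^ p / 2 := by positivity
  calc (|x| - -|x|) * (|x| ^ (p - 1) * (R * (1 / 2 + R * |x| ^ p / 2)⁻¹))
      = 2 * R * (|x| * |x| ^ (p - 1)) / (1 / 2 + R * |x| ^ p / 2) := by field_simp; ring
    _ ≤ 4 := by rw [hx, div_le_iff₀ h0]; linarith

/-! ### Convergence to the delta distribution on the diagonal -/

/-- The monomial `l₊^a l'₊^(p-1-a) l₋^b l'₋^(p-1-b)` in the two points `l` and `l'` of the plane. -/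
def pairMonomial (p a b : ℕ) (l : (ℝ × ℝ) × (ℝ × ℝ)) : ℝ :=
  (l.1.1 ^ a * l.2.1 ^ (p - 1 - a)) * (l.1.2 ^ b * l.2.2 ^ (p - 1 - b))

theorem continuous_pairMonomial (p a b : ℕ) : Continuous (pairMonomial p a b) := by
  unfold pairMonomial; fun_prop

/-- On the diagonal the monomial cancels the Jacobian of the power map up to the factor `p²`. -/
theorem pairMonomial_diag_div_jac {p a b : ℕ} (hp : Odd p) (ha : a < p) (hb : b < p) {l : ℝ × ℝ}
    (h1 : l.1 ≠ 0) (h2 : l.2 ≠ 0) :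
    pairMonomial p a b (l, l) / |powPairJac p l| = 1 / (p : ℝ) ^ 2 := by
  have he : Even (p - 1) := hp.tsub_odd odd_one
  have hp0 : (p : ℝ) ≠ 0 := by exact_mod_cast hp.pos.ne'
  have h3 : 0 < l.1 ^ (p - 1) := he.pow_pos h1
  have h4 : 0 < l.2 ^ (p - 1) := he.pow_pos h2
  have h5 : 0 ≤ powPairJac p l := by unfold powPairJac; positivity
  rw [abs_of_nonneg h5, pairMonomial, powPairJac, ← pow_add, ← pow_add,
    Nat.add_sub_cancel' (by omega), Nat.add_sub_cancel' (by omega)]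
  field_simp

/-- The inner integrals of the scaled kernel are bounded uniformly in `R` and in `l`. -/
theorem norm_integral_pair_kernel_le {p a b : ℕ} (hp : Odd p) (ha : a < p) (hb : b < p)
    {K : ℝ × ℝ → ℂ} {C M : ℝ} (hC : ∀ u, ‖K u‖ ≤ C * planeWeight u)
    {f : ℝ × ℝ → ℂ} (hf : ∀ y, ‖f y‖ ≤ M) {R : ℝ} (hR : 0 < R) (l : ℝ × ℝ) :
    ‖∫ y, ((R : ℂ) ^ 2 * K (R • (powPair p l - powPair p y))) *
        (f y * pairMonomial p a b (l, y))‖ ≤ C * M * monomialKernelBound p ^ 2 := by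
  have hM0 : 0 ≤ M := (norm_nonneg _).trans (hf 0)
  have hC0 : 0 ≤ C := nonneg_of_mul_nonneg_left ((norm_nonneg _).trans (hC 0)) (planeWeight_pos 0)
  set g : ℕ → ℝ → ℝ → ℝ := fun c x y =>
    |x| ^ c * |y| ^ (p - 1 - c) * (R * invSqWeight (R * (x ^ p - y ^ p))) with hg
  have hg0 : ∀ c x y, 0 ≤ g c x y := fun c x y => by
    have := invSqWeight_pos (R * (x ^ p - y ^ p))
    simp only [hg]
    positivity
  have hi := ((integrable_monomial_kernel hp ha hR l.1).mul_prod
    (integrable_monomial_kernel hp hb hR l.2)).const_mul (C * M)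
  refine (norm_integral_le_of_norm_le hi (Eventually.of_forall fun y => ?_)).trans ?_
  · rw [norm_mul, norm_mul, norm_mul, norm_pow, Complex.norm_real, Complex.norm_real,
      Real.norm_eq_abs, Real.norm_eq_abs, sq_abs]
    calc R ^ 2 * ‖K (R • (powPair p l - powPair p y))‖ * (‖f y‖ * |pairMonomial p a b (l, y)|)
        ≤ R ^ 2 * (C * planeWeight (R • (powPair p l - powPair p y))) *
          (M * |pairMonomial p a b (l, y)|) := by
          have := (planeWeight_pos (R • (powPair p l - powPair p y))).le
          gcongr
          · exact hC _
          · exact hf y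
      _ = _ := by
          simp only [planeWeight, powPair, pairMonomial, abs_mul, abs_pow, Prod.smul_fst,
            Prod.smul_snd, Prod.fst_sub, Prod.snd_sub, smul_eq_mul]
          ring
  · rw [integral_const_mul, integral_prod_mul (g a l.1) (g b l.2), sq]
    have h1 := integral_monomial_kernel_le hp ha hR l.1
    have h2 := integral_monomial_kernel_le hp hb hR l.2
    have h3 : 0 ≤ ∫ y, g b l.2 y := integral_nonneg (hg0 _ _)
    have h4 : 0 ≤ ∫ y, g a l.1 y := integral_nonneg (hg0 _ _)
    have h5 : 0 ≤ monomialKernelBound p := h3.trans h2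
    gcongr

/-- As distributions in `(l, l')`, the scaled kernels `R² K(R (lᵖ - l'ᵖ))` times a monomial of
degree `p - 1` in each coordinate pair converge to a multiple of the delta distribution on the
diagonal. -/
theorem tendsto_integral_pair_kernel {p a b : ℕ} (hp : Odd p) (ha : a < p) (hb : b < p)
    {K : ℝ × ℝ → ℂ} {C : ℝ} (hKc : Continuous K) (hC : ∀ u, ‖K u‖ ≤ C * planeWeight u)
    {Φ : (ℝ × ℝ) × (ℝ × ℝ) → ℂ} (hΦ : Continuous Φ) (hΦc : HasCompactSupport Φ) :
    Tendsto (fun R : ℝ => ∫ l : (ℝ × ℝ) × (ℝ × ℝ),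
        ((R : ℂ) ^ 2 * K (R • (powPair p l.1 - powPair p l.2))) * (Φ l * pairMonomial p a b l))
      atTop (𝓝 ((∫ u, K u) / (p : ℂ) ^ 2 * ∫ l : ℝ × ℝ, Φ (l, l))) := by
  have hcP := continuous_powPair p
  have hcM := continuous_pairMonomial p a b
  obtain ⟨M, hM⟩ := hΦc.exists_bound_of_continuous hΦ
  have hint : ∀ R : ℝ, Integrable fun l : (ℝ × ℝ) × (ℝ × ℝ) =>
      ((R : ℂ) ^ 2 * K (R • (powPair p l.1 - powPair p l.2))) * (Φ l * pairMonomial p a b l) :=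
    fun R => Continuous.integrable_of_hasCompactSupport (by fun_prop) (hΦc.mul_right.mul_left)
  set S : Set (ℝ × ℝ) := Prod.fst '' tsupport Φ with hS
  have hSc : IsCompact S := hΦc.isCompact.image continuous_fst
  have hzero : ∀ l ∉ S, ∀ y, Φ (l, y) = 0 := fun l hl y => by
    by_contra h
    exact hl ⟨(l, y), subset_tsupport _ h, rfl⟩
  have hslice : ∀ l, HasCompactSupport fun y => Φ (l, y) := fun l =>
    HasCompactSupport.intro (hΦc.isCompact.image continuous_snd) fun y hy => by
      by_contra h
      exact hy ⟨(l, y), subset_tsupport _ h, rfl⟩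
  rw [← integral_const_mul]
  have key : Tendsto (fun R : ℝ => ∫ l : ℝ × ℝ, ∫ y : ℝ × ℝ,
        ((R : ℂ) ^ 2 * K (R • (powPair p l - powPair p y))) *
          (Φ (l, y) * pairMonomial p a b (l, y)))
      atTop (𝓝 (∫ l : ℝ × ℝ, (∫ u, K u) / (p : ℂ) ^ 2 * Φ (l, l))) := by
    refine tendsto_integral_filter_of_dominated_convergence
      (S.indicator fun _ => C * M * monomialKernelBound p ^ 2) ?_ ?_ ?_ ?_
    · exact Eventually.of_forall fun R => (hint R).integral_prod_left.aestronglyMeasurable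
    · filter_upwards [eventually_gt_atTop 0] with R hR
      refine Eventually.of_forall fun l => ?_
      by_cases hl : l ∈ S
      · rw [Set.indicator_of_mem hl]
        exact norm_integral_pair_kernel_le hp ha hb hC (fun y => hM (l, y)) hR l
      · simp [hzero l hl, hl]
    · exact (integrable_indicator_iff hSc.measurableSet).2 (integrableOn_const hSc.measure_lt_top.ne)
    · filter_upwards [ae_coord_ne_zero] with l hl
      have h := tendsto_integral_power_kernel hp hKc hC
        (f := fun y => Φ (l, y) * pairMonomial p a b (l, y)) (by fun_prop)
        (Continuous.integrable_of_hasCompactSupport (by fun_prop) (hslice l).mul_right) hl.1 hl.2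
      have e : (∫ u, K u) * (Φ (l, l) * pairMonomial p a b (l, l) / |powPairJac p l|) =
          (∫ u, K u) / (p : ℂ) ^ 2 * Φ (l, l) := by
        rw [mul_div_assoc, ← Complex.ofReal_div, pairMonomial_diag_div_jac hp ha hb hl.1 hl.2]
        push_cast
        ring
      rwa [e] at h
  refine key.congr fun R => ?_
  rw [Measure.volume_eq_prod (ℝ × ℝ) (ℝ × ℝ), integral_prod _ (hint R)]

/-! ### Fourier integrals of test functions on the plane -/

/-- The Fourier integral `∫ ψ(z) exp(-i z·ξ) dz` over the plane. -/
def planeFourier (ψ : ℝ × ℝ → ℂ) (ξ : ℝ × ℝ) : ℂ :=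
  ∫ z : ℝ × ℝ, ψ z * Complex.exp (-Complex.I * (z.1 * ξ.1 + z.2 * ξ.2))

theorem planeFourier_comp_smul (ψ : ℝ × ℝ → ℂ) {R : ℝ} (hR : 0 < R) (ξ : ℝ × ℝ) :
    ∫ z : ℝ × ℝ, ψ (R⁻¹ • z) * Complex.exp (-Complex.I * (z.1 * ξ.1 + z.2 * ξ.2)) =
      (R : ℂ) ^ 2 * planeFourier ψ (R • ξ) := by
  have h := Measure.integral_comp_inv_smul_of_nonneg (volume : Measure (ℝ × ℝ))
    (fun w => ψ w * Complex.exp (-Complex.I * (w.1 * (R • ξ).1 + w.2 * (R • ξ).2))) hR.le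
  rw [Module.finrank_prod, Module.finrank_self, Complex.real_smul] at h
  rw [planeFourier]
  push_cast at h
  rw [← h]
  refine integral_congr_ae (Eventually.of_forall fun z => ?_)
  have hR0 : (R : ℂ) ≠ 0 := by exact_mod_cast hR.ne'
  simp only [Prod.smul_fst, Prod.smul_snd, smul_eq_mul]
  push_cast
  congr 2
  field_simp

/-- The plane as the complex line, which carries the Euclidean inner product. -/
def planeToComplex : (ℝ × ℝ) ≃L[ℝ] ℂ := Complex.equivRealProdCLM.symm

theorem measurePreserving_planeToComplex : MeasurePreserving planeToComplex :=
  Complex.volume_preserving_equiv_real_prod.symm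

section planeFourier

variable {ψ : ℝ × ℝ → ℂ} (hψ : ContDiff ℝ ∞ ψ) (hψc : HasCompactSupport ψ)

/-- A test function on the plane as a Schwartz function on the complex line. -/
def complexTest : SchwartzMap ℂ ℂ :=
  (hψc.comp_homeomorph planeToComplex.symm.toHomeomorph).toSchwartzMap
    (hψ.comp planeToComplex.symm.contDiff)

theorem complexTest_apply (w : ℂ) : complexTest hψ hψc w = ψ (w.re, w.im) := rfl

open FourierTransform in
theorem planeFourier_eq (ξ : ℝ × ℝ) :
    planeFourier ψ ξ = 𝓕 (complexTest hψ hψc) ((2 * Real.pi)⁻¹ • planeToComplex ξ) := by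
  rw [SchwartzMap.fourier_coe, Real.fourier_eq', planeFourier,
    ← measurePreserving_planeToComplex.integral_comp
      planeToComplex.toHomeomorph.measurableEmbedding]
  refine integral_congr_ae (Eventually.of_forall fun z => ?_)
  have e : inner ℝ (planeToComplex z) ((2 * Real.pi)⁻¹ • planeToComplex ξ) =
      (2 * Real.pi)⁻¹ * (z.1 * ξ.1 + z.2 * ξ.2) := by
    rw [inner_smul_right]
    congr 1
    rw [Complex.inner]
    simp [planeToComplex]
    ring
  simp only [e, smul_eq_mul, complexTest_apply]
  rw [mul_comm]
  have hpi : (Real.pi : ℂ) ≠ 0 := by exact_mod_cast Real.pi_ne_zero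
  congr 2
  push_cast
  field_simp

include hψ hψc in
theorem continuous_planeFourier : Continuous (planeFourier ψ) := by
  rw [show planeFourier ψ = _ from funext (planeFourier_eq hψ hψc)]
  exact (SchwartzMap.continuous _).comp (by fun_prop)

open FourierTransform in
include hψ hψc in
/-- Fourier inversion at the origin. -/
theorem integral_planeFourier : ∫ ξ, planeFourier ψ ξ = (2 * Real.pi : ℂ) ^ 2 * ψ 0 := by
  have h0 : 𝓕⁻ (𝓕 (complexTest hψ hψc)) 0 = ψ 0 := by
    rw [FourierTransform.fourierInv_fourier_eq, complexTest_apply]; rfl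
  rw [SchwartzMap.fourierInv_coe, Real.fourierInv_eq'] at h0
  simp only [inner_zero_right, mul_zero, Complex.ofReal_zero, zero_mul, Complex.exp_zero,
    one_smul] at h0
  simp only [planeFourier_eq hψ hψc]
  rw [measurePreserving_planeToComplex.integral_comp planeToComplex.toHomeomorph.measurableEmbedding
    (fun w => 𝓕 (complexTest hψ hψc) ((2 * Real.pi)⁻¹ • w)),
    Measure.integral_comp_inv_smul_of_nonneg _ _ (by positivity), h0, Complex.finrank_real_complex,
    Complex.real_smul]
  push_cast
  ring

open FourierTransform in
include hψ hψc in
theorem exists_norm_planeFourier_le : ∃ C, ∀ ξ, ‖planeFourier ψ ξ‖ ≤ C * planeWeight ξ := by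
  set f := 𝓕 (complexTest hψ hψc)
  obtain ⟨C, hC⟩ : ∃ C, ∀ w, (1 + ‖w‖) ^ 8 * ‖f w‖ ≤ C := by
    refine ⟨2 ^ 8 * (Finset.Iic (8, 0)).sup (fun m => SchwartzMap.seminorm ℝ m.1 m.2) f,
      fun w => ?_⟩
    have := SchwartzMap.one_add_le_sup_seminorm_apply (𝕜 := ℝ) (m := (8, 0)) le_rfl le_rfl f w
    rwa [norm_iteratedFDeriv_zero] at this
  refine ⟨(2 * Real.pi) ^ 8 * C, fun ξ => ?_⟩
  rw [planeFourier_eq hψ hψc]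
  set w := (2 * Real.pi)⁻¹ • planeToComplex ξ with hw
  have hpi : 1 ≤ 2 * Real.pi := by linarith [Real.pi_gt_three]
  have hn : ‖planeToComplex ξ‖ ^ 2 = ξ.1 ^ 2 + ξ.2 ^ 2 := by
    rw [← Complex.normSq_eq_norm_sq, Complex.normSq_apply]
    simp [planeToComplex]
    ring
  have h1 : 1 + ‖planeToComplex ξ‖ ≤ 2 * Real.pi * (1 + ‖w‖) := by
    rw [hw, norm_smul, norm_inv, Real.norm_of_nonneg (by positivity), mul_add,
      mul_inv_cancel_left₀ (by positivity)]
    linarith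
  have h2 : (1 + ξ.1 ^ 2) * (1 + ξ.2 ^ 2) ≤ (1 + ‖planeToComplex ξ‖) ^ 4 := by
    have h3 : (1 + ξ.1 ^ 2) * (1 + ξ.2 ^ 2) ≤ (1 + ‖planeToComplex ξ‖ ^ 2) ^ 2 := by
      rw [hn]; nlinarith [sq_nonneg ξ.1, sq_nonneg ξ.2, mul_nonneg (sq_nonneg ξ.1) (sq_nonneg ξ.2)]
    calc _ ≤ _ := h3
      _ ≤ ((1 + ‖planeToComplex ξ‖) ^ 2) ^ 2 := by
        gcongr; nlinarith [norm_nonneg (planeToComplex ξ)]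
      _ = _ := by ring
  have h4 : ((1 + ξ.1 ^ 2) * (1 + ξ.2 ^ 2)) ^ 2 * ‖f w‖ ≤ (2 * Real.pi) ^ 8 * C := by
    calc _ ≤ ((1 + ‖planeToComplex ξ‖) ^ 4) ^ 2 * ‖f w‖ := by gcongr
      _ ≤ ((2 * Real.pi * (1 + ‖w‖)) ^ 4) ^ 2 * ‖f w‖ := by gcongr
      _ = (2 * Real.pi) ^ 8 * ((1 + ‖w‖) ^ 8 * ‖f w‖) := by ring
      _ ≤ _ := by gcongr; exact hC w
  have e : planeWeight ξ = (((1 + ξ.1 ^ 2) * (1 + ξ.2 ^ 2)) ^ 2)⁻¹ := by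
    rw [planeWeight, invSqWeight, invSqWeight, ← mul_pow, ← mul_inv, inv_pow]
  rw [e, ← div_eq_mul_inv, le_div_iff₀ (by positivity), mul_comm]
  exact h4

end planeFourier

/-! ### q-factorials -/

section qNumbers

variable {p : ℕ} [NeZero p] {q : ℂ} [hq : Fact (IsPrimitiveRoot q p)]

include hq in
theorem conj_rootOfUnity : conj q = q⁻¹ :=
  (Complex.inv_eq_conj (hq.out.norm'_eq_one (NeZero.ne p))).symm

include hq in
theorem conj_qNum (n : ℕ) : conj (qNum q n) = qNum q n := by
  simp only [qNum, map_div₀, map_sub, map_pow, map_inv₀, conj_rootOfUnity (p := p) (q := q), inv_inv]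
  rw [← neg_sub (q ^ n), ← neg_sub q, neg_div_neg_eq]

include hq in
theorem conj_qFact (n : ℕ) : conj (qFact q n) = qFact q n := by
  simp only [qFact, map_prod, conj_qNum (p := p)]

include hq in
theorem qNum_compl {k : ℕ} (hk : k ≤ p) : qNum q (p - k) = -qNum q k := by
  have h0 : q ≠ 0 := hq.out.ne_zero (NeZero.ne p)
  rw [qNum, qNum, inv_pow, inv_pow, pow_sub₀ _ h0 hk, hq.out.pow_eq_one, one_mul, inv_inv, ← neg_div,
    neg_sub]

include hq in
/-- `[p - k] = -[k]` collapses all the products `[k]! [p-1-k]!` to `[p-1]!` up to sign. -/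
theorem qFact_mul_qFact_compl {k : ℕ} (hk : k < p) :
    qFact q k * qFact q (p - 1 - k) = (-1) ^ k * qFact q (p - 1) := by
  induction k with
  | zero => simp [qFact]
  | succ k ih =>
    have h1 : qFact q (k + 1) = qFact q k * qNum q (k + 1) := Finset.prod_range_succ _ _
    have h2 : qFact q (p - 1 - k) = qFact q (p - 1 - (k + 1)) * -qNum q (k + 1) := by
      obtain ⟨d, hd⟩ : ∃ d, p - 1 - k = d + 1 := ⟨p - 2 - k, by omega⟩
      rw [← qNum_compl hk.le, hd, show p - 1 - (k + 1) = d by omega,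
        show p - (k + 1) = d + 1 by omega]
      exact Finset.prod_range_succ _ _
    rw [h1, pow_succ]
    linear_combination (-1 : ℂ) * ih (by omega) + qFact q k * h2

theorem qPow_neg (t : ZMod p) : qPow p q (-t) = (qPow p q t)⁻¹ :=
  eq_inv_of_mul_eq_one_left (by rw [← qPow_add, neg_add_cancel, qPow_zero])

theorem inv_pow_eq_qPow (n : ℕ) : q⁻¹ ^ n = qPow p q (-n) := by
  rw [qPow_neg, qPow_natCast, inv_pow]

end qNumbers

/-! ### Monomials and the invariant integral -/

namespace RedPoincare

variable {p : ℕ} {q : ℂ}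

theorem IsSum.unique {y z x x' : PIdx p} (h : IsSum y z x) (h' : IsSum y z x') : x = x' :=
  Prod.ext (Fin.ext (h.1.symm.trans h'.1))
    (Prod.ext (Fin.ext (h.2.1.symm.trans h'.2.1)) (h.2.2.symm.trans h'.2.2))

variable [NeZero p]

/-- The exponents of the monomial `η₊^(p-1) η₋^(p-1)`, on which the invariant integral is
supported. -/
def topIdx (p : ℕ) [NeZero p] : PIdx p := (Fin.rev 0, Fin.rev 0, 0)

/-- The exponents complementary to `y` with respect to `topIdx`. -/
def complIdx (y : PIdx p) : PIdx p := (Fin.rev y.1, Fin.rev y.2.1, -y.2.2)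

theorem isSum_complIdx (y : PIdx p) : IsSum y (complIdx y) (topIdx p) := by
  refine ⟨?_, ?_, by simp [complIdx, topIdx]⟩ <;>
    · simp only [complIdx, topIdx, Fin.val_rev, Fin.val_zero]
      omega

theorem isSum_topIdx_iff {y z : PIdx p} : IsSum y z (topIdx p) ↔ z = complIdx y := by
  refine ⟨fun h => ?_, fun h => h ▸ isSum_complIdx y⟩
  have h' := isSum_complIdx y
  exact Prod.ext (Fin.ext (by have := h.1; have := h'.1; omega))
    (Prod.ext (Fin.ext (by have := h.2.1; have := h'.2.1; omega))
      (add_left_cancel (h.2.2.trans h'.2.2.symm)))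

theorem coeff_mul_topIdx (f g : RedPoincare p q) :
    (f * g).coeff (topIdx p) =
      ∑ y, qPow p q (twist y (complIdx y)) * (f.coeff y * g.coeff (complIdx y)) := by
  rw [coeff_mul]
  refine Finset.sum_congr rfl fun y _ => ?_
  rw [Finset.sum_eq_single (complIdx y)]
  · rw [sc, if_pos (isSum_complIdx y)]
  · intro z _ hz
    rw [sc, if_neg fun h => hz (isSum_topIdx_iff.1 h), zero_mul]
  · simp

theorem etaP_eq_mono (hp : 1 < p) : (etaP : RedPoincare p q) = mono p q (⟨1, hp⟩, 0, 0) := by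
  ext x
  rw [coeff_mono]
  simp only [etaP, coeff, Prod.ext_iff, Fin.ext_iff, Fin.val_zero]

theorem etaM_eq_mono (hp : 1 < p) : (etaM : RedPoincare p q) = mono p q (0, ⟨1, hp⟩, 0) := by
  ext x
  rw [coeff_mono]
  simp only [etaM, coeff, Prod.ext_iff, Fin.ext_iff, Fin.val_zero]

variable [hq : Fact (IsPrimitiveRoot q p)]

theorem mono_mul_mono {y z x : PIdx p} (h : IsSum y z x) :
    mono p q y * mono p q z = qPow p q (twist y z) • mono p q x := by
  ext u
  rw [mono_mul_coeff, Finset.sum_eq_single z (fun w _ hw => by simp [coeff_mono, hw]) (by simp),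
    coeff_smul, coeff_mono, coeff_mono, if_pos rfl, mul_one, sc]
  by_cases hu : u = x
  · rw [hu, if_pos h, if_pos rfl, mul_one]
  · rw [if_neg fun h' => hu (h'.unique h), if_neg hu, mul_zero]

theorem etaP_pow (hp : 1 < p) {a : ℕ} (ha : a < p) :
    (etaP : RedPoincare p q) ^ a = mono p q (⟨a, ha⟩, 0, 0) := by
  induction a with
  | zero => rw [pow_zero]; rfl
  | succ a ih =>
    rw [pow_succ, ih (by omega), etaP_eq_mono hp,
      mono_mul_mono (x := (⟨a + 1, ha⟩, 0, 0)) ⟨rfl, by simp, by simp⟩]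
    simp [twist, qPow_zero]

theorem etaM_pow (hp : 1 < p) {b : ℕ} (hb : b < p) :
    (etaM : RedPoincare p q) ^ b = mono p q (0, ⟨b, hb⟩, 0) := by
  induction b with
  | zero => rw [pow_zero]; rfl
  | succ b ih =>
    rw [pow_succ, ih (by omega), etaM_eq_mono hp,
      mono_mul_mono (x := (0, ⟨b + 1, hb⟩, 0)) ⟨by simp, rfl, by simp⟩]
    simp [twist, qPow_zero]

theorem etaP_pow_mul_etaM_pow (hp : 1 < p) (a b : Fin p) :
    (etaP : RedPoincare p q) ^ (a : ℕ) * etaM ^ (b : ℕ) = mono p q (a, b, 0) := by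
  rw [etaP_pow hp a.2, etaM_pow hp b.2, mono_mul_mono (x := (a, b, 0)) ⟨by simp, by simp, by simp⟩]
  simp [twist, qPow_zero]

theorem coeff_sum {ι : Type*} (S : Finset ι) (f : ι → RedPoincare p q) (x : PIdx p) :
    (∑ i ∈ S, f i).coeff x = ∑ i ∈ S, (f i).coeff x :=
  map_sum (⟨⟨fun f : RedPoincare p q => f.coeff x, rfl⟩, fun _ _ => rfl⟩ : RedPoincare p q →+ ℂ) f S

theorem coeff_star (f : RedPoincare p q) (x : PIdx p) :
    (star f).coeff x = qPow p q (starTwist x) * conj (f.coeff x) := rfl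

theorem invInt_mono (x : PIdx p) :
    invInt (mono p q x) = if x = topIdx p then q⁻¹ else 0 := by
  change ∑ y : PIdx p, (mono p q x).coeff y *
    (if (y.1 : ℕ) = p - 1 ∧ (y.2.1 : ℕ) = p - 1 ∧ y.2.2 = 0 then q⁻¹ else 0) = _
  rw [Finset.sum_eq_single x (fun w _ hw => by simp [coeff_mono, hw]) (by simp)]
  simp only [coeff_mono, topIdx, Prod.ext_iff, Fin.ext_iff, Fin.val_rev, Fin.val_zero, if_true,
    one_mul, zero_add]

end RedPoincare

/-! ### Forms, shifts and plane waves -/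

namespace QPoincare

open RedPoincare

variable {p : ℕ}

theorem formS_dlt (j k : ZMod p) : formS (dlt j) (dlt k) = if j + k = 0 then 1 else 0 := by
  simp [formS, intS, starS, dlt, AddMonoidAlgebra.single_mul_single, Finsupp.single_apply,
    AddMonoidAlgebra.coeff_single]

variable [NeZero p] {q : ℂ} [hq : Fact (IsPrimitiveRoot q p)]

theorem intE_eq (F : ℝ × ℝ → RedPoincare p q) :
    intE F = q⁻¹ * ∫ z : ℝ × ℝ, (F z).coeff (topIdx p) := by
  rw [intE, Finset.sum_eq_single (topIdx p)]
  · rw [invInt_mono, if_pos rfl]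
  · intro x _ hx
    rw [invInt_mono, if_neg hx, zero_mul]
  · simp

theorem formSA_single (n : ZMod p) (Y : ZMod p → RedPoincare p q) :
    formSA (Pi.single ((p : ZMod p) - n) 1) Y = Y n := by
  rw [formSA, Finset.sum_eq_single (-n)]
  · rw [Finset.sum_eq_single n]
    · simp [formS_dlt]
    · intro k _ hk
      rw [formS_dlt, if_neg fun h => hk (neg_add_eq_zero.1 h).symm, zero_smul]
    · simp
  · intro j _ hj
    refine Finset.sum_eq_zero fun k _ => ?_
    rw [Pi.single_eq_of_ne (by simpa using hj)]
    simp
  · simp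

/-- Powers of a weighted shift `δ^m ↦ c q^(-m) η δ^(m+e)`. -/
theorem weighted_shift_pow {W : Matrix (ZMod p) (ZMod p) (RedPoincare p q)} {c : ℂ} {e : ZMod p}
    {η : RedPoincare p q}
    (hW : ∀ j m, W j m = if j = m + e then (c * qPow p q (-m)) • η else 0) (k : ℕ) (j m : ZMod p) :
    (W ^ k) j m = if j = m + k * e then
      (c ^ k * qPow p q (-(k * m + e * (k.choose 2 : ℕ)))) • η ^ k else 0 := by
  induction k generalizing j with
  | zero => simp [Matrix.one_apply, qPow_zero]
  | succ k ih =>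
    rw [pow_succ', Matrix.mul_apply, Finset.sum_eq_single (m + k * e)]
    · rw [ih, if_pos rfl, hW]
      have e1 : m + ((k + 1 : ℕ) : ZMod p) * e = m + k * e + e := by push_cast; ring
      rw [e1]
      split_ifs with h
      · rw [smul_mul_smul_comm, ← pow_succ', Nat.choose_succ_succ' k 1, Nat.choose_one_right]
        congr 1
        have e2 : -(((k + 1 : ℕ) : ZMod p) * m + e * ((k + k.choose 2 : ℕ) : ZMod p)) =
            -(m + k * e) + -(k * m + e * (k.choose 2 : ℕ)) := by push_cast; ring
        rw [e2, qPow_add]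
        ring
      · rw [zero_mul]
    · intro i _ hi
      rw [ih, if_neg hi, mul_zero]
    · simp

theorem Lp_pow (l : ℝ × ℝ) (k : ℕ) (j m : ZMod p) :
    ((Lp l : Matrix (ZMod p) (ZMod p) ℂ) ^ k) j m = if j = m + k then (l.1 : ℂ) ^ k else 0 := by
  induction k generalizing j with
  | zero => simp [Matrix.one_apply]
  | succ k ih =>
    rw [pow_succ', Matrix.mul_apply, Finset.sum_eq_single (m + k)]
    · rw [ih, if_pos rfl, Lp, Matrix.of_apply, Nat.cast_succ, ← add_assoc, ite_mul, zero_mul,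
        ← pow_succ']
    · intro i _ hi
      rw [ih, if_neg hi, mul_zero]
    · simp

theorem Lm_pow (l : ℝ × ℝ) (k : ℕ) (j m : ZMod p) :
    ((Lm l : Matrix (ZMod p) (ZMod p) ℂ) ^ k) j m = if j = m - k then (l.2 : ℂ) ^ k else 0 := by
  induction k generalizing j with
  | zero => simp [Matrix.one_apply]
  | succ k ih =>
    rw [pow_succ', Matrix.mul_apply, Finset.sum_eq_single (m - k)]
    · rw [ih, if_pos rfl, Lm, Matrix.of_apply, Nat.cast_succ, ← sub_sub, ite_mul, zero_mul,
        ← pow_succ']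
    · intro i _ hi
      rw [ih, if_neg hi, mul_zero]
    · simp

/-- `P₊` and `P₋` act as scalars, so the exponential factor of `T` is a scalar plane wave. -/
theorem exp_momentum (l z : ℝ × ℝ) :
    NormedSpace.exp ((-Complex.I * z.1) • (Lp l : Matrix (ZMod p) (ZMod p) ℂ) ^ p +
      (-Complex.I * z.2) • (Lm l : Matrix (ZMod p) (ZMod p) ℂ) ^ p) =
    Matrix.diagonal fun _ => Complex.exp (-Complex.I * (z.1 * l.1 ^ p + z.2 * l.2 ^ p)) := by
  have h : (-Complex.I * z.1) • (Lp l : Matrix (ZMod p) (ZMod p) ℂ) ^ p +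
      (-Complex.I * z.2) • (Lm l : Matrix (ZMod p) (ZMod p) ℂ) ^ p =
      Matrix.diagonal fun _ => -Complex.I * (z.1 * l.1 ^ p + z.2 * l.2 ^ p) := by
    ext j m
    rw [Matrix.add_apply, Matrix.smul_apply, Matrix.smul_apply, Lp_pow, Lm_pow,
      ZMod.natCast_self, add_zero, sub_zero, Matrix.diagonal_apply]
    split_ifs with hjm
    · simp only [smul_eq_mul]; ring
    · simp
  rw [h, Matrix.exp_diagonal]
  congr 1
  ext i
  rw [Pi.coe_exp, Complex.exp_eq_exp_ℂ]

/-- The factor `D(L(κ), δ)` fixes the vector `δ^0 ⊗ 1`. -/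
theorem DKap_apply_zero (j : ZMod p) : DKap p q j 0 = if j = 0 then 1 else 0 := by
  have hL : ∀ m : ℕ, (Lk p q ^ m) j 0 = if j = 0 then 1 else 0 := fun m => by
    rw [Lk, Matrix.diagonal_pow, Matrix.diagonal_apply]
    split_ifs with h
    · simp [h, qPow_zero]
    · rfl
  have hp0 : (p : ℂ) ≠ 0 := by exact_mod_cast NeZero.ne p
  have hsum : ∀ k ∈ Finset.range p,
      ∑ m ∈ Finset.range p, q⁻¹ ^ (m * k) = if k = 0 then (p : ℂ) else 0 := by
    intro k hk
    split_ifs with h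
    · simp [h]
    · have h1 : q⁻¹ ^ k ≠ 1 := fun h1 => h (Nat.eq_zero_of_dvd_of_lt
        (hq.out.inv.dvd_of_pow_eq_one k h1) (Finset.mem_range.1 hk))
      simp only [mul_comm _ k, pow_mul]
      have h2 := geom_sum_mul (q⁻¹ ^ k) p
      rw [← pow_mul, mul_comm k p, pow_mul, hq.out.inv.pow_eq_one, one_pow, sub_self] at h2
      exact (mul_eq_zero.1 h2).resolve_right (sub_ne_zero.2 h1)
  rw [DKap, Matrix.smul_apply, Matrix.sum_apply]
  simp only [Matrix.sum_apply, Matrix.smul_apply, tens, Matrix.map_apply, hL]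
  split_ifs with h
  · rw [Finset.sum_comm]
    simp only [one_smul, ← Finset.sum_smul]
    rw [Finset.sum_congr rfl fun k hk => by rw [hsum k hk],
      Finset.sum_eq_single_of_mem 0 (Finset.mem_range.2 (NeZero.pos p)) fun k _ hk => by
        rw [if_neg hk, zero_smul]]
    rw [if_pos rfl, pow_zero, smul_smul, one_div, inv_mul_cancel₀ hp0, one_smul]
  · simp

end QPoincare

/-! ### Matrix elements of the representation -/

namespace QPoincare

open RedPoincare

variable {p : ℕ} [NeZero p] {q : ℂ} [hq : Fact (IsPrimitiveRoot q p)]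

theorem tens_Lep_apply (s : ℂ) (l : ℝ × ℝ) (η : RedPoincare p q) (j m : ZMod p) :
    tens (Complex.I • Lep q s l) η j m =
      if j = m + 1 then ((-Complex.I * s⁻¹ * l.1) * qPow p q (-m)) • η else 0 := by
  rw [tens, Matrix.map_apply, Lep, Matrix.smul_apply, Matrix.smul_apply, LkInv,
    Matrix.mul_diagonal, Lp, Matrix.of_apply]
  split_ifs with h
  · simp only [smul_eq_mul]; congr 1; ring
  · simp

theorem tens_Lem_apply (s : ℂ) (l : ℝ × ℝ) (η : RedPoincare p q) (j m : ZMod p) :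
    tens (Complex.I • Lem q s l) η j m =
      if j = m + -1 then ((-Complex.I * s * l.2) * qPow p q (-m)) • η else 0 := by
  rw [tens, Matrix.map_apply, Lem, Matrix.smul_apply, Matrix.smul_apply, LkInv,
    Matrix.mul_diagonal, Lm, Matrix.of_apply, sub_eq_add_neg]
  split_ifs with h
  · simp only [smul_eq_mul]; congr 1; ring
  · simp

/-- The first q-exponential: its quadratic powers of `q` cancel those produced by the shift. -/
theorem cutExp_Lep_apply (s : ℂ) (l : ℝ × ℝ) (η : RedPoincare p q) (j m : ZMod p) :
    cutExp q (tens (Complex.I • Lep q s l) η) j m =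
      ∑ a ∈ Finset.range p, if j = m + a then
        ((-Complex.I * s⁻¹ * l.1) ^ a * qPow p q (-(a * m)) / qFact q a) • η ^ a else 0 := by
  rw [cutExp, Matrix.sum_apply]
  refine Finset.sum_congr rfl fun a _ => ?_
  rw [Matrix.smul_apply, weighted_shift_pow (tens_Lep_apply s l η), mul_one]
  split_ifs with h
  · rw [smul_smul, ← Nat.choose_two_right, ← qPow_natCast p, one_mul, neg_add, qPow_add,
      qPow_neg ((a.choose 2 : ℕ) : ZMod p)]
    have h0 : qPow p q ((a.choose 2 : ℕ) : ZMod p) ≠ 0 := by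
      rw [qPow_natCast]; exact pow_ne_zero _ (hq.out.ne_zero (NeZero.ne p))
    congr 1
    field_simp
  · rw [smul_zero]

/-- The second q-exponential on the vector `δ^0`. -/
theorem cutExp_Lem_apply_zero (s : ℂ) (l : ℝ × ℝ) (η : RedPoincare p q) (j : ZMod p) :
    cutExp q⁻¹ (tens (Complex.I • Lem q s l) η) j 0 =
      ∑ b ∈ Finset.range p, if j = -(b : ZMod p) then
        ((-Complex.I * s * l.2) ^ b / qFact q b) • η ^ b else 0 := by
  rw [cutExp, Matrix.sum_apply]
  refine Finset.sum_congr rfl fun b _ => ?_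
  rw [Matrix.smul_apply, weighted_shift_pow (tens_Lem_apply s l η), mul_neg_one, zero_add]
  split_ifs with h
  · rw [smul_smul, ← Nat.choose_two_right, inv_pow_eq_qPow (p := p), mul_zero, zero_add, neg_one_mul,
      neg_neg, qPow_neg]
    have h0 : qPow p q ((b.choose 2 : ℕ) : ZMod p) ≠ 0 := by
      rw [qPow_natCast]; exact pow_ne_zero _ (hq.out.ne_zero (NeZero.ne p))
    congr 1
    field_simp
  · rw [smul_zero]

variable (p q) in
/-- The coefficient of `η₊^a η₋^b` in the matrix elements `D^l_{n0}` with `n = a - b`, up to the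
plane wave. -/
def matCoeff (s : ℂ) (l : ℝ × ℝ) (a b : ℕ) : ℂ :=
  (-Complex.I * s⁻¹ * l.1) ^ a * (-Complex.I * s * l.2) ^ b * qPow p q (a * b) /
    (qFact q a * qFact q b)

/-- The plane wave `exp(-i (z₊ l₊^p + z₋ l₋^p))`. -/
def planeWave (p : ℕ) (l z : ℝ × ℝ) : ℂ :=
  Complex.exp (-Complex.I * (z.1 * l.1 ^ p + z.2 * l.2 ^ p))

theorem T_apply_zero (s : ℂ) (l z : ℝ × ℝ) (n : ZMod p) :
    T q s l z n 0 = planeWave p l z • ∑ a : Fin p, ∑ b : Fin p,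
      if n = (a : ℕ) - (b : ℕ) then
        matCoeff p q s l a b • (etaP ^ (a : ℕ) * etaM ^ (b : ℕ)) else 0 := by
  have hE : tens (Matrix.diagonal fun _ : ZMod p => planeWave p l z) (1 : RedPoincare p q) =
      Matrix.diagonal fun _ => planeWave p l z • (1 : RedPoincare p q) := by
    rw [tens, Matrix.diagonal_map (zero_smul ℂ (1 : RedPoincare p q))]
  rw [T, exp_momentum, mul_assoc, mul_assoc]
  change (tens (Matrix.diagonal fun _ : ZMod p => planeWave p l z) (1 : RedPoincare p q) *
    (_ : Matrix (ZMod p) (ZMod p) (RedPoincare p q))) n 0 = _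
  rw [hE, Matrix.diagonal_mul, smul_one_mul, Matrix.mul_apply]
  congr 1
  have hv : ∀ i,
      (cutExp q⁻¹ (tens (Complex.I • Lem q s l) (etaM : RedPoincare p q)) * DKap p q) i 0 =
      ∑ b ∈ Finset.range p, if i = -(b : ZMod p) then
        ((-Complex.I * s * l.2) ^ b / qFact q b) • etaM ^ b else 0 := fun i => by
    rw [Matrix.mul_apply, Finset.sum_eq_single 0, DKap_apply_zero, if_pos rfl, mul_one,
      cutExp_Lem_apply_zero]
    · intro k _ hk
      rw [DKap_apply_zero, if_neg hk, mul_zero]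
    · simp
  simp only [hv, Finset.mul_sum]
  rw [Finset.sum_comm, Finset.sum_comm (s := (Finset.univ : Finset (Fin p))),
    ← Fin.sum_univ_eq_sum_range (fun b => ∑ i : ZMod p,
      cutExp q (tens (Complex.I • Lep q s l) (etaP : RedPoincare p q)) n i *
        if i = -(b : ZMod p) then
          ((-Complex.I * s * l.2) ^ b / qFact q b) • etaM ^ b else 0)]
  refine Finset.sum_congr rfl fun b _ => ?_
  rw [Finset.sum_eq_single (-((b : ℕ) : ZMod p)), if_pos rfl, cutExp_Lep_apply, Finset.sum_mul,
    ← Fin.sum_univ_eq_sum_range (fun a => (if n = -((b : ℕ) : ZMod p) + a then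
      ((-Complex.I * s⁻¹ * l.1) ^ a * qPow p q (-(a * -((b : ℕ) : ZMod p))) / qFact q a) •
        (etaP : RedPoincare p q) ^ a else 0) *
      ((-Complex.I * s * l.2) ^ (b : ℕ) / qFact q b) • etaM ^ (b : ℕ))]
  · refine Finset.sum_congr rfl fun a _ => ?_
    rw [neg_add_eq_sub, mul_neg, neg_neg]
    split_ifs with h
    · rw [smul_mul_smul_comm, matCoeff]
      congr 1
      rw [mul_comm (qFact q a)]
      ring
    · rw [zero_mul]
  · intro i _ hi
    rw [if_neg hi, mul_zero]
  · simp

variable (p q) in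
/-- The `z`-independent factor of the matrix element `D^l_{n0}`. -/
def matElt (s : ℂ) (l : ℝ × ℝ) (n : ZMod p) : RedPoincare p q := fun x =>
  if x.2.2 = 0 ∧ n = (x.1 : ℕ) - (x.2.1 : ℕ) then matCoeff p q s l x.1 x.2.1 else 0

omit [NeZero p] hq in
theorem coeff_matElt (s : ℂ) (l : ℝ × ℝ) (n : ZMod p) (x : PIdx p) :
    (matElt p q s l n).coeff x =
      if x.2.2 = 0 ∧ n = (x.1 : ℕ) - (x.2.1 : ℕ) then matCoeff p q s l x.1 x.2.1 else 0 := rfl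

theorem D_eq (hp : 1 < p) (s : ℂ) (l z : ℝ × ℝ) (n : ZMod p) :
    D q s l n 0 z = planeWave p l z • matElt p q s l n := by
  rw [D, formSA_single, T_apply_zero]
  congr 1
  ext x
  rw [coeff_matElt, coeff_sum]
  simp only [coeff_sum, etaP_pow_mul_etaM_pow hp]
  rw [Finset.sum_eq_single x.1, Finset.sum_eq_single x.2.1]
  · by_cases h : n = (x.1 : ℕ) - (x.2.1 : ℕ)
    · rw [if_pos h, coeff_smul, coeff_mono]
      by_cases h0 : x.2.2 = 0
      · have hx : x = (x.1, x.2.1, 0) := Prod.ext rfl (Prod.ext rfl h0)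
        rw [if_pos hx, if_pos ⟨h0, h⟩, mul_one]
      · have hx : x ≠ (x.1, x.2.1, 0) := fun h' => h0 (congrArg (fun y : PIdx p => y.2.2) h')
        rw [if_neg hx, if_neg fun h' => h0 h'.1, mul_zero]
    · rw [if_neg h, if_neg fun h' => h h'.2, coeff_zero]
  · intro b _ hb
    split_ifs
    · rw [coeff_smul, coeff_mono, if_neg fun h => hb (congrArg (·.2.1) h).symm, mul_zero]
    · rfl
  · simp
  · intro a _ ha
    refine Finset.sum_eq_zero fun b _ => ?_
    split_ifs
    · rw [coeff_smul, coeff_mono, if_neg fun h => ha (congrArg (·.1) h).symm, mul_zero]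
    · rfl
  · simp

omit [NeZero p] hq in
theorem phase_pair_mul {c : ℂ} (hc : c ≠ 0) (x y : ℝ) {a : ℕ} (ha : a < p) :
    (-Complex.I * c * x) ^ a * (Complex.I * c⁻¹ * y) ^ (p - 1 - a) =
      (-1) ^ a * Complex.I ^ (p - 1) * (c ^ 2) ^ a * c⁻¹ ^ (p - 1) *
        ((x : ℂ) ^ a * (y : ℂ) ^ (p - 1 - a)) := by
  obtain ⟨d, hd⟩ : ∃ d, p - 1 = a + d := ⟨p - 1 - a, by omega⟩
  have h1 : (c ^ 2) ^ a * c⁻¹ ^ a = c ^ a := by rw [← mul_pow]; congr 1; field_simp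
  rw [hd, Nat.add_sub_cancel_left, pow_add, pow_add, neg_mul, neg_mul, neg_pow, mul_pow, mul_pow,
    mul_pow, mul_pow, ← h1]
  ring

theorem conj_matCoeff {s : ℂ} (hs : conj s = s⁻¹) (l : ℝ × ℝ) (a b : ℕ) :
    conj (matCoeff p q s l a b) =
      (Complex.I * s * l.1) ^ a * (Complex.I * s⁻¹ * l.2) ^ b * qPow p q (-(a * b)) /
        (qFact q a * qFact q b) := by
  simp only [matCoeff, map_div₀, map_mul, map_pow, map_neg, Complex.conj_I, map_inv₀, hs, inv_inv,
    Complex.conj_ofReal, conj_qPow, conj_qFact (p := p), neg_neg]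

/-- All phases and powers of `q` cancel in the product of complementary coefficients. -/
theorem matCoeff_compl_mul (hp : Odd p) {s : ℂ} (hs : s ^ 2 = q) (l l' : ℝ × ℝ) (a b : Fin p) :
    qPow p q (twist (a, b, 0) (complIdx (a, b, 0))) *
      (matCoeff p q s l a b * (qPow p q (starTwist (complIdx (a, b, 0))) *
        conj (matCoeff p q s l' (Fin.rev a) (Fin.rev b)))) =
      q * (pairMonomial p a b (l, l') / qFact q (p - 1) ^ 2) := by
  have hq0 : q ≠ 0 := hq.out.ne_zero (NeZero.ne p)
  have hs0 : s ≠ 0 := by rintro rfl; exact hq0 (by rw [← hs]; ring)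
  have hsn : ‖s‖ = 1 := by
    have h := hq.out.norm'_eq_one (NeZero.ne p)
    rw [← hs, norm_pow] at h
    exact (pow_eq_one_iff_of_nonneg (norm_nonneg _) two_ne_zero).1 h
  have hrev : ∀ c : Fin p, ((Fin.rev c : Fin p) : ℕ) = p - 1 - c := fun c => by
    rw [Fin.val_rev]; omega
  have hcast : ∀ c : Fin p, ((p - 1 - (c : ℕ) : ℕ) : ZMod p) = -1 - (c : ℕ) := fun c => by
    have h := c.2
    rw [Nat.cast_sub (by omega), Nat.cast_sub (by omega), ZMod.natCast_self, Nat.cast_one, zero_sub]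
  rw [conj_matCoeff (Complex.inv_eq_conj hsn).symm, matCoeff]
  simp only [twist, starTwist, complIdx, hrev, hcast, neg_zero, mul_zero, zero_mul, sub_zero]
  set A : ZMod p := ((a : ℕ) : ZMod p)
  set B : ZMod p := ((b : ℕ) : ZMod p)
  have hpow : qPow p q (2 * B * (-1 - A)) * qPow p q (A * B) *
      qPow p q (2 * (-1 - A) * (-1 - B)) * qPow p q (-((-1 - A) * (-1 - B))) =
      q * q ^ (a : ℕ) * q⁻¹ ^ (b : ℕ) := by
    rw [← qPow_add, ← qPow_add, ← qPow_add, inv_pow_eq_qPow (p := p), ← qPow_natCast p q a]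
    have e1 : q = qPow p q 1 := by simpa using (qPow_natCast p q 1).symm
    conv_rhs => lhs; lhs; rw [e1]
    rw [← qPow_add, ← qPow_add]
    congr 1
    ring
  have h1 := phase_pair_mul (inv_ne_zero hs0) l.1 l'.1 a.2
  have h2 := phase_pair_mul hs0 l.2 l'.2 b.2
  rw [inv_inv, inv_pow, hs] at h1
  rw [hs] at h2
  have h3 := qFact_mul_qFact_compl (q := q) a.2
  have h4 := qFact_mul_qFact_compl (q := q) b.2
  have hI : Complex.I ^ (p - 1) * Complex.I ^ (p - 1) = 1 := by
    rw [← mul_pow, Complex.I_mul_I, (hp.tsub_odd odd_one).neg_one_pow]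
  have hsgn : ∀ c : ℕ, ((-1 : ℂ) ^ c)⁻¹ = (-1) ^ c := fun c => by rw [← inv_pow]; norm_num
  have hss : s ^ (p - 1) * s⁻¹ ^ (p - 1) = 1 := by
    rw [← mul_pow, mul_inv_cancel₀ hs0, one_pow]
  have hqa : q ^ (a : ℕ) * q⁻¹ ^ (a : ℕ) = 1 := by rw [← mul_pow, mul_inv_cancel₀ hq0, one_pow]
  have hqb : q ^ (b : ℕ) * q⁻¹ ^ (b : ℕ) = 1 := by rw [← mul_pow, mul_inv_cancel₀ hq0, one_pow]
  have hsq : ∀ c : ℕ, (-1 : ℂ) ^ c * (-1) ^ c = 1 := fun c => by rw [← mul_pow]; norm_num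
  calc _ = (qPow p q (2 * B * (-1 - A)) * qPow p q (A * B) *
        qPow p q (2 * (-1 - A) * (-1 - B)) * qPow p q (-((-1 - A) * (-1 - B)))) *
        ((-Complex.I * s⁻¹ * l.1) ^ (a : ℕ) * (Complex.I * s * l'.1) ^ (p - 1 - a)) *
        ((-Complex.I * s * l.2) ^ (b : ℕ) * (Complex.I * s⁻¹ * l'.2) ^ (p - 1 - b)) /
        ((qFact q a * qFact q (p - 1 - a)) * (qFact q b * qFact q (p - 1 - b))) := by
        simp only [div_eq_mul_inv, mul_inv]
        ring
    _ = q * ((Complex.I ^ (p - 1) * Complex.I ^ (p - 1)) * (s ^ (p - 1) * s⁻¹ ^ (p - 1)) *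
        (q ^ (a : ℕ) * q⁻¹ ^ (a : ℕ)) * (q ^ (b : ℕ) * q⁻¹ ^ (b : ℕ)) *
        ((-1) ^ (a : ℕ) * (-1) ^ (a : ℕ)) * ((-1) ^ (b : ℕ) * (-1) ^ (b : ℕ)) *
        (pairMonomial p a b (l, l') / qFact q (p - 1) ^ 2)) := by
        rw [hpow, h1, h2, h3, h4, pairMonomial]
        simp only [div_eq_mul_inv, mul_inv, hsgn, inv_pow]
        push_cast
        ring
    _ = _ := by rw [hI, hss, hqa, hqb, hsq, hsq]; ring

end QPoincare

/-! ### The Hermitian form of two matrix elements -/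

namespace QPoincare

open RedPoincare

variable {p : ℕ} [NeZero p] {q : ℂ} [hq : Fact (IsPrimitiveRoot q p)]

/-- The index condition for complementary exponents forces `n + m = 0`. -/
theorem coeff_topIdx_matElt_mul_star (hp : Odd p) {s : ℂ} (hs : s ^ 2 = q) (l l' : ℝ × ℝ)
    {n m : ZMod p} :
    ∑ y : PIdx p, qPow p q (twist y (complIdx y)) * ((matElt p q s l n).coeff y *
      (qPow p q (starTwist (complIdx y)) * conj ((matElt p q s l' m).coeff (complIdx y)))) =
    if n + m = 0 then q * ∑ a : Fin p, ∑ b : Fin p, if n = (a : ℕ) - (b : ℕ) then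
      (pairMonomial p a b (l, l') : ℂ) / qFact q (p - 1) ^ 2 else 0 else 0 := by
  have hcast : ∀ c : Fin p, (((Fin.rev c : Fin p) : ℕ) : ZMod p) = -1 - (c : ℕ) := fun c => by
    rw [Fin.val_rev, Nat.cast_sub (by omega), ZMod.natCast_self]
    push_cast
    ring
  have key : ∀ a b : Fin p, ∑ c : ZMod p, qPow p q (twist (a, b, c) (complIdx (a, b, c))) *
      ((matElt p q s l n).coeff (a, b, c) * (qPow p q (starTwist (complIdx (a, b, c))) *
        conj ((matElt p q s l' m).coeff (complIdx (a, b, c))))) =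
      if n + m = 0 then (q * if n = (a : ℕ) - (b : ℕ) then
        (pairMonomial p a b (l, l') : ℂ) / qFact q (p - 1) ^ 2 else 0) else 0 := by
    intro a b
    rw [Finset.sum_eq_single 0]
    · rw [coeff_matElt, coeff_matElt]
      simp only [complIdx, neg_zero, true_and, hcast]
      by_cases hn : n = (a : ℕ) - (b : ℕ)
      · have hm : m = -1 - (a : ℕ) - (-1 - (b : ℕ)) ↔ n + m = 0 := by
          rw [hn]
          constructor
          · rintro rfl; ring
          · intro h; linear_combination h
        rw [if_pos hn, if_pos hn]
        by_cases h : n + m = 0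
        · rw [if_pos h, if_pos (hm.2 h)]
          simpa only [complIdx, neg_zero] using matCoeff_compl_mul hp hs l l' a b
        · rw [if_neg h, if_neg fun h' => h (hm.1 h')]
          simp
      · rw [if_neg hn, if_neg hn]
        simp
    · intro c _ hc
      rw [coeff_matElt, if_neg fun h => hc h.1]
      simp
    · simp
  rw [Fintype.sum_prod_type]
  simp only [Fintype.sum_prod_type, key]
  split_ifs
  · simp only [Finset.mul_sum]
  · simp

omit [NeZero p] in
theorem planeWave_mul_conj (l l' z : ℝ × ℝ) :
    planeWave p l z * conj (planeWave p l' z) =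
      Complex.exp (-Complex.I * (z.1 * (powPair p l - powPair p l').1 +
        z.2 * (powPair p l - powPair p l').2)) := by
  rw [planeWave, planeWave, ← Complex.exp_conj, ← Complex.exp_add]
  congr 1
  simp only [map_mul, map_add, map_neg, map_pow, Complex.conj_I, Complex.conj_ofReal, powPair,
    Prod.fst_sub, Prod.snd_sub]
  push_cast
  ring

theorem formE_cutoff_D (hp : Odd p) (hp1 : 1 < p) {s : ℂ} (hs : s ^ 2 = q) (n m : ZMod p)
    (χ : ℝ × ℝ → ℂ) {R : ℝ} (hR : 0 < R) (l : (ℝ × ℝ) × (ℝ × ℝ)) :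
    formE (cutoff χ R (D q s l.1 n 0)) (cutoff χ R (D q s l.2 m 0)) =
      if n + m = 0 then ∑ a : Fin p, ∑ b : Fin p, if n = (a : ℕ) - (b : ℕ) then
        (1 / qFact q (p - 1) ^ 2) * (((R : ℂ) ^ 2 * planeFourier (fun z => χ z * conj (χ z))
          (R • (powPair p l.1 - powPair p l.2))) * pairMonomial p a b l) else 0 else 0 := by
  have hq0 : q ≠ 0 := hq.out.ne_zero (NeZero.ne p)
  rw [formE, intE_eq]
  have h : ∀ z : ℝ × ℝ, (cutoff χ R (D q s l.1 n 0) z *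
      star (cutoff χ R (D q s l.2 m 0) z)).coeff (topIdx p) =
      ((χ (R⁻¹ • z) * conj (χ (R⁻¹ • z))) * Complex.exp (-Complex.I *
        (z.1 * (powPair p l.1 - powPair p l.2).1 + z.2 * (powPair p l.1 - powPair p l.2).2))) *
      ∑ y : PIdx p, qPow p q (twist y (complIdx y)) * ((matElt p q s l.1 n).coeff y *
        (qPow p q (starTwist (complIdx y)) * conj ((matElt p q s l.2 m).coeff (complIdx y)))) := by
    intro z
    rw [coeff_mul_topIdx, Finset.mul_sum, ← planeWave_mul_conj]
    refine Finset.sum_congr rfl fun y _ => ?_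
    simp only [coeff_star, cutoff, D_eq hp1, coeff_smul, map_mul]
    ring
  simp only [h]
  rw [integral_mul_const, planeFourier_comp_smul (fun z => χ z * conj (χ z)) hR,
    coeff_topIdx_matElt_mul_star hp hs]
  split_ifs
  · rw [mul_left_comm, inv_mul_cancel_left₀ hq0, Finset.mul_sum]
    refine Finset.sum_congr rfl fun a _ => ?_
    rw [Finset.mul_sum]
    refine Finset.sum_congr rfl fun b _ => ?_
    split_ifs
    · ring
    · rw [mul_zero]
  · rw [mul_zero, mul_zero]

theorem memA₀_cutoff_D (hp1 : 1 < p) (s : ℂ) (n : ZMod p) {χ : ℝ × ℝ → ℂ} (hχ : ContDiff ℝ ∞ χ)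
    (hχc : HasCompactSupport χ) (l : ℝ × ℝ) {R : ℝ} (hR : 0 < R) :
    MemA₀ (cutoff χ R (D q s l n 0)) := by
  intro x
  have e : (fun z => (cutoff χ R (D q s l n 0) z).coeff x) = fun z =>
      χ (R⁻¹ • z) * (planeWave p l z * (matElt p q s l n).coeff x) := by
    funext z
    rw [cutoff, D_eq hp1, coeff_smul, coeff_smul]
  rw [e]
  have hz1 : ContDiff ℝ ∞ fun z : ℝ × ℝ => (z.1 : ℂ) := Complex.ofRealCLM.contDiff.comp contDiff_fst
  have hz2 : ContDiff ℝ ∞ fun z : ℝ × ℝ => (z.2 : ℂ) := Complex.ofRealCLM.contDiff.comp contDiff_snd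
  refine ⟨(hχ.comp (contDiff_const_smul _)).mul (ContDiff.mul (ContDiff.cexp ?_) contDiff_const), ?_⟩
  · exact contDiff_const.mul ((hz1.mul contDiff_const).add (hz2.mul contDiff_const))
  · exact (hχc.comp_smul (inv_ne_zero hR.ne')).mul_right

omit hq in
theorem sum_ite_eq_sub (n : ZMod p) (c : ℂ) :
    ∑ a : Fin p, ∑ b : Fin p, (if n = (a : ℕ) - (b : ℕ) then c else 0) = p * c := by
  have h : ∀ a : Fin p, ∑ b : Fin p, (if n = (a : ℕ) - (b : ℕ) then c else 0) = c := by
    intro a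
    have h0 : ∀ b : Fin p, n = (a : ℕ) - (b : ℕ) ↔
        b = (⟨(((a : ℕ) : ZMod p) - n).val, ZMod.val_lt _⟩ : Fin p) := fun b => by
      rw [Fin.ext_iff]
      constructor
      · rintro rfl
        simp only [sub_sub_cancel, ZMod.val_natCast, Nat.mod_eq_of_lt b.2]
      · intro hb
        rw [hb, ZMod.natCast_val, ZMod.cast_id', id, sub_sub_cancel]
    simp only [h0, Finset.sum_ite_eq', Finset.mem_univ, if_true]
  simp [h]

theorem Lam_eq : Lam p q = p * (1 / qFact q (p - 1) ^ 2 * ((2 * Real.pi : ℂ) ^ 2 / (p : ℂ) ^ 2)) := by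
  have h : ∀ k ∈ Finset.range p,
      1 / (qFact q k * qFact q (p - 1 - k)) ^ 2 = 1 / qFact q (p - 1) ^ 2 := fun k hk => by
    rw [qFact_mul_qFact_compl (Finset.mem_range.1 hk), mul_pow, ← pow_mul, mul_comm k 2, pow_mul]
    norm_num
  rw [Lam, Finset.sum_congr rfl h, Finset.sum_const, Finset.card_range, nsmul_eq_mul]
  ring

end QPoincare

open QPoincare in
/-- With `s = q^(1/2)` any square root of `q`. The identity
`(D^λ_{n0}, D^λ'_{m0})_E = Λ δ(λ₊ - λ'₊) δ(λ₋ - λ'₋) δ_{n+m ≡ 0 mod p}` is one of distributions in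
`(λ, λ') ∈ ℝ² × ℝ²`: the left side is the limit of the forms of the elements `χ(z / R) D^λ` of
`A₀(E_q(1,1))` as `R → ∞`, for every smooth compactly supported cutoff `χ` with `χ(0) = 1`. -/
theorem proposition4 (p : ℕ) [NeZero p] (hp : Odd p) (hp1 : 1 < p) (q : ℂ)
    [Fact (IsPrimitiveRoot q p)] (s : ℂ) (hs : s ^ 2 = q) (n m : ZMod p)
    (χ : ℝ × ℝ → ℂ) (hχ : ContDiff ℝ ∞ χ) (hχc : HasCompactSupport χ) (hχ0 : χ 0 = 1) :
    (∀ (l : ℝ × ℝ) (R : ℝ), 0 < R → MemA₀ (cutoff χ R (D q s l n 0))) ∧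
    ∀ Φ : (ℝ × ℝ) × (ℝ × ℝ) → ℂ, ContDiff ℝ ∞ Φ → HasCompactSupport Φ →
      (∀ R : ℝ, 0 < R → Integrable (fun l : (ℝ × ℝ) × (ℝ × ℝ) =>
        Φ l * formE (cutoff χ R (D q s l.1 n 0)) (cutoff χ R (D q s l.2 m 0)))) ∧
      Tendsto (fun R : ℝ => ∫ l : (ℝ × ℝ) × (ℝ × ℝ),
          Φ l * formE (cutoff χ R (D q s l.1 n 0)) (cutoff χ R (D q s l.2 m 0)))
        atTop (𝓝 (if n + m = 0 then Lam p q * ∫ l : ℝ × ℝ, Φ (l, l) else 0)) := by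
  refine ⟨fun l R hR => memA₀_cutoff_D hp1 s n hχ hχc l hR, fun Φ hΦ hΦc => ?_⟩
  have hψ : ContDiff ℝ ∞ fun z => χ z * conj (χ z) :=
    hχ.mul (Complex.conjCLE.contDiff.comp hχ)
  have hψc : HasCompactSupport fun z => χ z * conj (χ z) := hχc.mul_right
  set K := planeFourier fun z => χ z * conj (χ z) with hK
  have hKc : Continuous K := continuous_planeFourier hψ hψc
  obtain ⟨C, hC⟩ := exists_norm_planeFourier_le hψ hψc
  have hKi : ∫ u, K u = (2 * Real.pi : ℂ) ^ 2 := by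
    rw [hK, integral_planeFourier hψ hψc, hχ0, map_one, mul_one, mul_one]
  by_cases hnm : n + m = 0
  swap
  · have h0 : ∀ R : ℝ, 0 < R → ∀ l : (ℝ × ℝ) × (ℝ × ℝ),
        Φ l * formE (cutoff χ R (D q s l.1 n 0)) (cutoff χ R (D q s l.2 m 0)) = 0 := fun R hR l => by
      rw [formE_cutoff_D hp hp1 hs n m χ hR, if_neg hnm, mul_zero]
    refine ⟨fun R hR => by
      simp only [h0 R hR]
      exact integrable_zero _ _ _, ?_⟩
    rw [if_neg hnm]
    refine tendsto_const_nhds.congr' ?_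
    filter_upwards [eventually_gt_atTop 0] with R hR
    simp only [h0 R hR, integral_zero]
  set k : ℝ → Fin p → Fin p → (ℝ × ℝ) × (ℝ × ℝ) → ℂ := fun R a b l =>
    ((R : ℂ) ^ 2 * K (R • (powPair p l.1 - powPair p l.2))) * (Φ l * pairMonomial p a b l) with hk
  have hki : ∀ R a b, Integrable (k R a b) := fun R a b => by
    have h1 := continuous_powPair p
    have h2 := continuous_pairMonomial p a b
    have h3 := hΦ.continuous
    exact Continuous.integrable_of_hasCompactSupport (by fun_prop) hΦc.mul_right.mul_left
  have hform : ∀ R : ℝ, 0 < R → (fun l : (ℝ × ℝ) × (ℝ × ℝ) =>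
      Φ l * formE (cutoff χ R (D q s l.1 n 0)) (cutoff χ R (D q s l.2 m 0))) =
      fun l => ∑ a : Fin p, ∑ b : Fin p, if n = (a : ℕ) - (b : ℕ) then
        (1 / qFact q (p - 1) ^ 2) * k R a b l else 0 := fun R hR => by
    funext l
    rw [formE_cutoff_D hp hp1 hs n m χ hR, if_pos hnm, Finset.mul_sum]
    refine Finset.sum_congr rfl fun a _ => ?_
    rw [Finset.mul_sum]
    refine Finset.sum_congr rfl fun b _ => ?_
    split_ifs
    · simp only [hk]; ring
    · rw [mul_zero]
  have hterm : ∀ R (a b : Fin p), Integrable fun l => if n = (a : ℕ) - (b : ℕ) then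
      (1 / qFact q (p - 1) ^ 2) * k R a b l else 0 := fun R a b => by
    split_ifs
    · exact (hki R a b).const_mul _
    · exact integrable_zero _ _ _
  refine ⟨fun R hR => ?_, ?_⟩
  · rw [hform R hR]
    exact integrable_finsetSum _ fun a _ => integrable_finsetSum _ fun b _ => hterm R a b
  · rw [if_pos hnm]
    have hlim : Tendsto (fun R : ℝ => ∑ a : Fin p, ∑ b : Fin p, if n = (a : ℕ) - (b : ℕ) then
        (1 / qFact q (p - 1) ^ 2) * ∫ l, k R a b l else 0) atTop
        (𝓝 (∑ a : Fin p, ∑ b : Fin p, if n = (a : ℕ) - (b : ℕ) then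
          (1 / qFact q (p - 1) ^ 2) * ((∫ u, K u) / (p : ℂ) ^ 2 * ∫ l : ℝ × ℝ, Φ (l, l)) else 0)) := by
      refine tendsto_finsetSum _ fun a _ => tendsto_finsetSum _ fun b _ => ?_
      split_ifs
      · exact (tendsto_integral_pair_kernel hp a.2 b.2 hKc hC hΦ.continuous hΦc).const_mul _
      · exact tendsto_const_nhds
    rw [sum_ite_eq_sub, hKi] at hlim
    rw [Lam_eq]
    convert hlim.congr' ?_ using 2
    · ring
    · filter_upwards [eventually_gt_atTop 0] with R hR
      rw [hform R hR, integral_finsetSum _ fun a _ => integrable_finsetSum _ fun b _ => hterm R a b]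
      refine Finset.sum_congr rfl fun a _ => ?_
      rw [integral_finsetSum _ fun b _ => hterm R a b]
      refine Finset.sum_congr rfl fun b _ => ?_
      split_ifs
      · rw [integral_const_mul]
      · rw [integral_zero]

end
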